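/- **Setting.** Let $\mathbb T$ be the unit circle in $\mathbb C$, let $\mathbb T_Q=\{e^{2\pi i q}:q\in\mathbb Q\}$, and let $\mathbb Z_+=\{0,1,2,\dots\}$. Let $H(\mathbb T)$ be the compact abelian group of all (not necessarily continuous) group homomorphisms $\mathbb T\to\mathbb T$, with pointwise multiplication and the topology of pointwise convergence. For $n\in\mathbb Z$ let $n^\times\in H(\mathbb T)$ be the map $x\mapsto x^n$. Let $s(k,j)\in\mathbb Z$ be the (signed) Stirling numbers of the first kind, given by $n(n-1)\cdots(n-k+1)=\sum_{j=0}^k s(k,j)n^j$, and let $\varphi^{(j)}$ be the $j$-fold composition of $\varphi$. Let $\mathcal H$ be the set of all sequences $(\varphi_k)_{k\ge 0}\in H(\mathbb T)^{\mathbb Z_+}$ such that $\varphi_0=1^\times$ and $$\varphi_k(x^{k!})=\prod_{j=1}^k\varphi_1^{(j)}\bigl(x^{s(k,j)}\bigr)\qquad\text{for all } k\ge 1,\ x\in\mathbb T_Q,$$ with the topology induced by the product topology. The formula $T(\varphi_0,\varphi_1,\varphi_2,\dots)=(\varphi_0,\varphi_0\varphi_1,\varphi_1\varphi_2,\dots)$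 defines a homeomorphism $T:\mathcal H\to\mathcal H$. Put $\tilde 0=(1^\times,0^\times,0^\times,\dots)\in\mathcal H$ and $\tilde n=T^n\tilde 0$ for $n\in\mathbb Z$. The set $\mathcal H$ is a monoid with identity $\tilde 0$ under the operation $(\varphi\star\psi)_k=\prod_{j=0}^k\varphi_{k-j}\circ\psi_j$. For a topological space $X$, let $\mathcal C(X)$ be the algebra of bounded continuous functions $X\to\mathbb C$, and define $\omega_{\tilde 0}:\mathcal C(\mathcal H)\to l^\infty(\mathbb Z)$ by $\omega_{\tilde 0}f(n)=f(\tilde n)$. The Weyl algebra $\mathcal W$ is the smallest closed linear subspace of $l^\infty(\mathbb Z)$ that contains all sequences $n\mapsto e^{2\pi i p(n)}$ with $p$ a real polynomial; it is a unital $C^*$-subalgebra of $l^\infty(\mathbb Z)$. **Theorem.** For the system $(\mathcal H,T)$: 1. $\omega_{\tilde 0}\,\mathcal C(\mathcal H)=\mathcal W$. 2. $\mathcal H$ is the spectrum of $\mathcal W$: there is a homeomorphism $e$ from $\mathcal H$ onto the space of characters of $\mathcal W$ (with the weak-$*$ topology) such that $e(\varphi)(\omega_{\tilde 0}f)=f(\varphi)$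 for all $\varphi\in\mathcal H$ and $f\in\mathcal C(\mathcal H)$. 3. With $\tau(n)=\tilde n$, the pair $(\tau,\mathcal H)$ is a $\mathcal W$-compactification of $\mathbb Z$. That is, $(\mathcal H,\star)$ is a compact Hausdorff semigroup in which all maps $\varphi\mapsto\varphi\star\psi$ are continuous; $\tau:\mathbb Z\to\mathcal H$ is a homomorphism with dense image; for every $n\in\mathbb Z$ the map $\varphi\mapsto\tilde n\star\varphi$ is continuous; and $\{f\circ\tau: f\in\mathcal C(\mathcal H)\}=\mathcal W$. Moreover $(\mathcal H,\star)$ is a group, and $\tau$ is injective. -/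

import Mathlib

open scoped ENNReal BoundedContinuousFunction

noncomputable section

namespace WeylSystem

/-! ### Bounded sequences, orbit representations, the Weyl algebra -/

/-- The C*-algebra of bounded two-sided complex sequences. -/
abbrev LInfty : Type := lp (fun _ : ℤ => ℂ) ∞

lemma memLInfty_comp {X : Type*} [TopologicalSpace X] (α : ℤ → X) (f : X →ᵇ ℂ) :
    Memℓp (fun n : ℤ => f (α n)) ∞ := by
  refine memℓp_infty ⟨‖f‖, ?_⟩
  rintro _ ⟨n, rfl⟩
  exact f.norm_coe_le_norm _

/-- The adjoint `α* : C(X) → l^∞`, `α* f (n) = f (α n)`, of a map `α : ℤ → X`. -/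
def pullback {X : Type*} [TopologicalSpace X] (α : ℤ → X) (f : X →ᵇ ℂ) : LInfty :=
  ⟨fun n : ℤ => f (α n), memLInfty_comp α f⟩

/-- The representation `ω_x : C(X) → l^∞`, `ω_x f (n) = f (s^n x)`, attached to a homeomorphism `s`
of `X` and a point `x`. Here `s ^ n` is the integer iterate, in the group of homeomorphisms. -/
def omega {X : Type*} [TopologicalSpace X] (s : X ≃ₜ X) (x : X) (f : X →ᵇ ℂ) : LInfty :=
  pullback (fun n : ℤ => (s ^ n) x) f

/-- Functions of polynomial type: `n ↦ e^{2π i p(n)}` with `p` a real polynomial. -/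
def polyType : Set LInfty :=
  {f | ∃ p : Polynomial ℝ, ∀ n : ℤ,
    f n = Complex.exp (2 * Real.pi * Complex.I * ((p.eval (n : ℝ) : ℝ) : ℂ))}

/-- The smallest closed linear subspace of `l^∞` that contains all functions of polynomial type. -/
def weylSubmodule : Submodule ℂ LInfty := (Submodule.span ℂ polyType).topologicalClosure

lemma polyType_mul {f g : LInfty} (hf : f ∈ polyType) (hg : g ∈ polyType) : f * g ∈ polyType := by
  obtain ⟨p, hp⟩ := hf
  obtain ⟨q, hq⟩ := hg
  refine ⟨p + q, fun n => ?_⟩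
  have : (f * g) n = f n * g n := rfl
  rw [this, hp, hq, ← Complex.exp_add, Polynomial.eval_add]
  push_cast
  ring_nf

lemma polyType_star {f : LInfty} (hf : f ∈ polyType) : star f ∈ polyType := by
  obtain ⟨p, hp⟩ := hf
  refine ⟨-p, fun n => ?_⟩
  have : (star f) n = star (f n) := rfl
  rw [this, hp, Complex.star_def, ← Complex.exp_conj]
  simp [Complex.conj_ofNat]

lemma polyType_one : (1 : LInfty) ∈ polyType :=
  ⟨0, fun n => by
    have : (1 : LInfty) n = 1 := rfl
    simp [this]⟩

lemma span_polyType_mul {f g : LInfty} (hf : f ∈ Submodule.span ℂ polyType)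
    (hg : g ∈ Submodule.span ℂ polyType) : f * g ∈ Submodule.span ℂ polyType := by
  have h := Submodule.mul_mem_mul hf hg
  rw [Submodule.span_mul_span] at h
  refine Submodule.span_mono ?_ h
  rintro _ ⟨a, ha, b, hb, rfl⟩
  exact polyType_mul ha hb

lemma span_polyType_star {f : LInfty} (hf : f ∈ Submodule.span ℂ polyType) :
    star f ∈ Submodule.span ℂ polyType := by
  induction hf using Submodule.span_induction with
  | mem x hx => exact Submodule.subset_span (polyType_star hx)
  | zero => simp
  | add x y _ _ hx hy => rw [star_add]; exact Submodule.add_mem _ hx hy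
  | smul a x _ hx => rw [star_smul]; exact Submodule.smul_mem _ _ hx

/-- The Weyl algebra: the closed span `weylSubmodule`, with its structure of a unital C*-subalgebra
of `l^∞`. -/
def weylAlgebra : StarSubalgebra ℂ LInfty where
  carrier := weylSubmodule
  mul_mem' {f g} hf hg :=
    map_mem_closure₂ continuous_mul hf hg (fun _ ha _ hb => span_polyType_mul ha hb)
  add_mem' {f g} hf hg := weylSubmodule.add_mem hf hg
  algebraMap_mem' r := by
    rw [Algebra.algebraMap_eq_smul_one]
    exact weylSubmodule.smul_mem r
      (Submodule.le_topologicalClosure _ (Submodule.subset_span polyType_one))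
  star_mem' {f} hf :=
    map_mem_closure continuous_star hf (fun _ ha => span_polyType_star ha)

/-! ### Compactifications of `ℤ` -/

/-- `(α, X)` is an `A`-compactification of `ℤ`: `X` is a compact Hausdorff right topological
semigroup, `α : ℤ → X` is a homomorphism with dense image contained in the topological centre
of `X`, and `α* C(X) = A`. -/
structure IsCompactification (A : Set LInfty) (X : Type*) [TopologicalSpace X] [Semigroup X]
    (α : ℤ → X) : Prop where
  compact : CompactSpace X
  hausdorff : T2Space X
  continuous_mul_right : ∀ s : X, Continuous (fun x : X => x * s)
  map_add : ∀ m n : ℤ, α (m + n) = α m * α n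
  dense : DenseRange α
  centre : ∀ n : ℤ, Continuous (fun x : X => α n * x)
  range_pullback : Set.range (pullback (X := X) α) = A

/-! ### The group of all (not necessarily continuous) characters -/

/-- `H(G)`: all group homomorphisms from `G` to the circle, with pointwise multiplication and the
topology of pointwise convergence, as a subgroup of the product `Circle ^ G`. -/
def charGroup (G : Type*) [CommGroup G] : Subgroup (G → Circle) where
  carrier := {φ | ∀ x y, φ (x * y) = φ x * φ y}
  mul_mem' {a b} ha hb x y := by
    simp only [Pi.mul_apply, ha x y, hb x y]; exact mul_mul_mul_comm _ _ _ _
  one_mem' x y := by simp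
  inv_mem' {a} ha x y := by
    simp only [Pi.inv_apply, ha x y]; exact mul_inv _ _

/-- `H(𝕋)`, the group of all endomorphisms of the circle group. -/
abbrev HT : Type := charGroup Circle

/-- An element of `H(𝕋)` as a Mathlib homomorphism. -/
def toHom (φ : HT) : Circle →* Circle := MonoidHom.mk' φ.1 φ.2

/-- The homomorphism `x ↦ x ^ n`. -/
def powHom (n : ℤ) : HT := ⟨fun x => x ^ n, fun x y => mul_zpow x y n⟩

/-- Composition in `H(𝕋)`. -/
def comp (φ ψ : HT) : HT :=
  ⟨fun x => φ.1 (ψ.1 x), fun x y => by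
    show φ.1 (ψ.1 (x * y)) = _
    rw [ψ.2, φ.2]⟩

/-! ### The automorphism `A_G` -/

/-- `A_G (g₀, g₁, g₂, …) = (g₀, g₀ g₁, g₁ g₂, …)`. -/
def shiftMul {G : Type*} [CommGroup G] (g : ℕ → G) : ℕ → G
  | 0 => g 0
  | k + 1 => g k * g (k + 1)

/-- The inverse of `A_G`. -/
def shiftMulInv {G : Type*} [CommGroup G] (g : ℕ → G) : ℕ → G
  | 0 => g 0
  | k + 1 => g (k + 1) / shiftMulInv g k

lemma shiftMul_inv {G : Type*} [CommGroup G] (g : ℕ → G) : shiftMul (shiftMulInv g) = g := by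
  funext k
  cases k with
  | zero => rfl
  | succ k => simp [shiftMul, shiftMulInv]

lemma shiftMulInv_mul {G : Type*} [CommGroup G] (g : ℕ → G) : shiftMulInv (shiftMul g) = g := by
  funext k
  induction k with
  | zero => rfl
  | succ k ih => simp [shiftMul, shiftMulInv, ih]

/-! ### The space `𝓗` -/

/-- The roots of unity `𝕋_Q = {e^{2π i q} : q ∈ ℚ}`. -/
def ratCircle : Set Circle := {x | ∃ q : ℚ, x = Circle.exp (2 * Real.pi * (q : ℝ))}

/-- The (signed) Stirling number of the first kind: the coefficient of `n ^ j` in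
`n (n - 1) ⋯ (n - k + 1)`. -/
def stirling (k j : ℕ) : ℤ := (descPochhammer ℤ k).coeff j

/-- The set `𝓗` of the sequences `(φ_k)` in `H(𝕋)` with `φ_0 = id` and
`φ_k(x^{k!}) = ∏_{j=1}^k φ_1^{(j)}(x^{s(k,j)})` for all `k ≥ 1` and `x ∈ 𝕋_Q`, where `φ_1^{(j)}` is
the `j`-fold composition. -/
def setH : Set (ℕ → HT) :=
  {φ | φ 0 = powHom 1 ∧ ∀ k : ℕ, 1 ≤ k → ∀ x ∈ ratCircle,
    (φ k).1 (x ^ k.factorial) = ∏ j ∈ Finset.Icc 1 k, (φ 1).1^[j] (x ^ stirling k j)}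

/-- The space `𝓗`, with the topology induced by the product topology of `H(𝕋)^{ℤ₊}`. -/
abbrev H : Type := setH

lemma toHom_apply (φ : HT) (x : Circle) : toHom φ x = φ.1 x := rfl

lemma map_zpow' (φ : HT) (x : Circle) (n : ℤ) : φ.1 (x ^ n) = φ.1 x ^ n :=
  map_zpow (toHom φ) x n

lemma map_torsion (φ : HT) {N : ℕ} {x : Circle} (hx : x ^ N = 1) : φ.1 x ^ N = 1 := by
  have := map_pow (toHom φ) x N
  rw [hx, map_one] at this
  exact this.symm

lemma coe_prod {ι : Type*} (s : Finset ι) (f : ι → HT) (x : Circle) :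
    (∏ i ∈ s, f i : HT).1 x = ∏ i ∈ s, (f i).1 x := by
  have : (∏ i ∈ s, f i : HT).1 = ∏ i ∈ s, (f i).1 :=
    map_prod (charGroup Circle).subtype f s
  rw [this, Finset.prod_apply]

lemma prod_zpow_eq {ι : Type*} (s : Finset ι) (e : ι → ℤ) (x : Circle) :
    ∏ i ∈ s, x ^ e i = x ^ ∑ i ∈ s, e i := by
  classical
  induction s using Finset.induction_on with
  | empty => simp
  | insert a s ha ih => rw [Finset.prod_insert ha, Finset.sum_insert ha, zpow_add, ih]

lemma ratCircle_torsion {x : Circle} (hx : x ∈ ratCircle) : ∃ N : ℕ, 0 < N ∧ x ^ N = 1 := by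
  obtain ⟨q, rfl⟩ := hx
  refine ⟨q.den, q.den_pos, ?_⟩
  have hq : (q : ℝ) * q.den = q.num := by exact_mod_cast Rat.mul_den_eq_num q
  rw [← Circle.exp_nsmul, Circle.exp_eq_one]
  refine ⟨q.num, ?_⟩
  rw [nsmul_eq_mul, ← hq]
  ring

lemma torsion_eq_exp {N : ℕ} (hN : 0 < N) {x : Circle} (hx : x ^ N = 1) :
    ∃ i : ℕ, x = Circle.exp (2 * Real.pi / N) ^ i := by
  have : NeZero N := ⟨hN.ne'⟩
  have h1 : (x : ℂ) ^ N = 1 := by exact_mod_cast congrArg (fun y : Circle => (y : ℂ)) hx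
  obtain ⟨i, _, hi⟩ := (Complex.isPrimitiveRoot_exp N hN.ne').eq_pow_of_pow_eq_one h1
  refine ⟨i, ?_⟩
  apply Circle.ext
  rw [← hi, Circle.coe_pow, Circle.coe_exp]
  push_cast
  ring_nf

lemma torsion_root {N m : ℕ} (hN : 0 < N) (hm : 0 < m) {x : Circle} (hx : x ^ N = 1) :
    ∃ y ∈ ratCircle, y ^ m = x := by
  obtain ⟨i, rfl⟩ := torsion_eq_exp hN hx
  refine ⟨Circle.exp (2 * Real.pi * ((i / (N * m) : ℚ) : ℝ)), ⟨_, rfl⟩, ?_⟩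
  rw [← Circle.exp_nsmul, ← Circle.exp_nsmul]
  congr 1
  have : (N : ℝ) ≠ 0 := by positivity
  have : (m : ℝ) ≠ 0 := by positivity
  simp only [nsmul_eq_mul]
  push_cast
  field_simp

/-- On `N`-torsion every element of `H(𝕋)` is a power map. -/
lemma exists_zpow (φ : HT) {N : ℕ} (hN : 0 < N) :
    ∃ n : ℤ, ∀ x : Circle, x ^ N = 1 → φ.1 x = x ^ n := by
  have hz : Circle.exp (2 * Real.pi / N) ^ N = 1 := by
    rw [← Circle.exp_nsmul, Circle.exp_eq_one]
    refine ⟨1, ?_⟩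
    have : (N : ℝ) ≠ 0 := by positivity
    simp only [nsmul_eq_mul]
    push_cast
    field_simp
  obtain ⟨n, hn⟩ := torsion_eq_exp hN (map_torsion φ hz)
  refine ⟨n, fun x hx => ?_⟩
  obtain ⟨i, rfl⟩ := torsion_eq_exp hN hx
  have h1 := map_zpow' φ (Circle.exp (2 * Real.pi / N)) i
  rw [zpow_natCast, zpow_natCast] at h1
  rw [h1, hn, zpow_natCast, ← pow_mul, ← pow_mul, mul_comm n i]

lemma zpow_torsion {N : ℕ} {x : Circle} (hx : x ^ N = 1) (n : ℤ) : (x ^ n) ^ N = 1 := by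
  rw [← zpow_natCast, ← zpow_mul, mul_comm, zpow_mul, zpow_natCast, hx, one_zpow]

lemma iterate_zpow {φ : HT} {N : ℕ} {n : ℤ} (h : ∀ x : Circle, x ^ N = 1 → φ.1 x = x ^ n)
    {x : Circle} (hx : x ^ N = 1) (j : ℕ) : φ.1^[j] x = x ^ (n ^ j) := by
  induction j with
  | zero => simp
  | succ j ih =>
    rw [Function.iterate_succ_apply', ih, h _ (zpow_torsion hx _), ← zpow_mul, pow_succ]

lemma sum_stirling {k : ℕ} (hk : 1 ≤ k) (n : ℤ) :
    ∑ j ∈ Finset.Icc 1 k, stirling k j * n ^ j = k.factorial * Ring.choose n k := by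
  have h := Ring.descPochhammer_eq_factorial_smul_choose n k
  rw [← Polynomial.eval_eq_smeval, Polynomial.eval_eq_sum_range, nsmul_eq_mul,
    descPochhammer_natDegree] at h
  rw [← h, Finset.range_eq_Ico, Finset.sum_eq_sum_Ico_succ_bot (by omega)]
  have h0 : (descPochhammer ℤ k).coeff 0 = 0 := by
    rw [Polynomial.coeff_zero_eq_eval_zero]
    exact descPochhammer_ne_zero_eval_zero ℤ (by omega)
  rw [h0]
  simp only [zero_mul, zero_add]
  rfl

lemma prod_stirling {φ : HT} {N : ℕ} {n : ℤ} (h : ∀ x : Circle, x ^ N = 1 → φ.1 x = x ^ n)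
    {x : Circle} (hx : x ^ N = 1) {k : ℕ} (hk : 1 ≤ k) :
    ∏ j ∈ Finset.Icc 1 k, φ.1^[j] (x ^ stirling k j) = (x ^ k.factorial) ^ Ring.choose n k := by
  rw [← zpow_natCast, ← zpow_mul, ← sum_stirling hk, ← prod_zpow_eq]
  refine Finset.prod_congr rfl fun j _ => ?_
  rw [iterate_zpow h (zpow_torsion hx _), ← zpow_mul]

/-- Membership in `𝓗`, read off on torsion elements. -/
lemma mem_setH_iff (φ : ℕ → HT) :
    φ ∈ setH ↔ φ 0 = powHom 1 ∧ ∀ k N : ℕ, 0 < N → ∃ n : ℤ, ∀ i ≤ k, ∀ x : Circle,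
      x ^ N = 1 → (φ i).1 x = x ^ Ring.choose n i := by
  constructor
  · rintro ⟨h0, h⟩
    refine ⟨h0, fun k N hN => ?_⟩
    obtain ⟨n, hn⟩ := exists_zpow (φ 1) (Nat.mul_pos hN k.factorial_pos)
    refine ⟨n, fun i hi x hx => ?_⟩
    rcases Nat.eq_zero_or_pos i with rfl | hi0
    · rw [h0, Ring.choose_zero_right]; rfl
    · obtain ⟨y, hy, rfl⟩ := torsion_root hN i.factorial_pos hx
      obtain ⟨c, hc⟩ := Nat.factorial_dvd_factorial hi
      rw [h i hi0 y hy]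
      refine prod_stirling hn ?_ hi0
      rw [← pow_mul] at hx
      rw [show N * k.factorial = i.factorial * N * c by rw [hc]; ring, pow_mul, hx, one_pow]
  · rintro ⟨h0, h⟩
    refine ⟨h0, fun k hk x hx => ?_⟩
    obtain ⟨N, hN, hxN⟩ := ratCircle_torsion hx
    obtain ⟨n, hn⟩ := h k N hN
    have h1 : ∀ x : Circle, x ^ N = 1 → (φ 1).1 x = x ^ n := fun x hx => by
      rw [hn 1 hk x hx, Ring.choose_one_right]
    rw [prod_stirling h1 hxN hk]
    refine hn k le_rfl _ ?_
    rw [← pow_mul, mul_comm, pow_mul, hxN, one_pow]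

/-! ### The homeomorphism `T` of `𝓗` -/

lemma coe_mul_apply (φ ψ : HT) (x : Circle) : (φ * ψ).1 x = φ.1 x * ψ.1 x := rfl

lemma coe_div_apply (φ ψ : HT) (x : Circle) : (φ / ψ).1 x = φ.1 x / ψ.1 x := rfl

lemma shiftMul_mem {φ : ℕ → HT} (hφ : φ ∈ setH) : shiftMul φ ∈ setH := by
  rw [mem_setH_iff] at hφ ⊢
  refine ⟨hφ.1, fun k N hN => ?_⟩
  obtain ⟨n, hn⟩ := hφ.2 k N hN
  refine ⟨n + 1, fun i hi x hx => ?_⟩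
  cases i with
  | zero => simpa [shiftMul] using hn 0 hi x hx
  | succ i =>
    rw [shiftMul, coe_mul_apply, hn i (by omega) x hx, hn (i + 1) hi x hx,
      Ring.choose_succ_succ, zpow_add]

lemma shiftMulInv_mem {φ : ℕ → HT} (hφ : φ ∈ setH) : shiftMulInv φ ∈ setH := by
  rw [mem_setH_iff] at hφ ⊢
  refine ⟨hφ.1, fun k N hN => ?_⟩
  obtain ⟨n, hn⟩ := hφ.2 k N hN
  refine ⟨n - 1, fun i => ?_⟩
  induction i with
  | zero => intro hi x hx; simpa [shiftMulInv] using hn 0 hi x hx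
  | succ i ih =>
    intro hi x hx
    have h := Ring.choose_succ_succ (n - 1) i
    rw [sub_add_cancel] at h
    rw [shiftMulInv, coe_div_apply, ih (by omega) x hx, hn (i + 1) hi x hx, h, zpow_add,
      mul_div_cancel_left]

lemma continuous_shiftMul : Continuous (shiftMul (G := HT)) := by
  refine continuous_pi fun k => ?_
  cases k with
  | zero => exact continuous_apply 0
  | succ k => exact (continuous_apply k).mul (continuous_apply (k + 1))

lemma continuous_shiftMulInv : Continuous (shiftMulInv (G := HT)) := by
  refine continuous_pi fun k => ?_
  induction k with
  | zero => exact continuous_apply 0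
  | succ k ih => exact (continuous_apply (k + 1)).div' ih

/-- The homeomorphism `T` of `𝓗`, the restriction of `A_{H(𝕋)}`. -/
def T : H ≃ₜ H where
  toFun φ := ⟨shiftMul φ.1, shiftMul_mem φ.2⟩
  invFun φ := ⟨shiftMulInv φ.1, shiftMulInv_mem φ.2⟩
  left_inv φ := Subtype.ext (shiftMulInv_mul φ.1)
  right_inv φ := Subtype.ext (shiftMul_inv φ.1)
  continuous_toFun := (continuous_shiftMul.comp continuous_subtype_val).subtype_mk _
  continuous_invFun := (continuous_shiftMulInv.comp continuous_subtype_val).subtype_mk _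

/-- The sequence `(id, 1, 1, …)`. -/
def zeroSeq : ℕ → HT := fun k => if k = 0 then powHom 1 else powHom 0

lemma zeroSeq_mem : zeroSeq ∈ setH := by
  rw [mem_setH_iff]
  refine ⟨rfl, fun k N _ => ⟨0, fun i _ x _ => ?_⟩⟩
  rw [Ring.choose_zero_ite]
  unfold zeroSeq
  split_ifs <;> rfl

/-- The base point of `𝓗`. -/
def zeroH : H := ⟨zeroSeq, zeroSeq_mem⟩

/-- The map `τ : ℤ → 𝓗`, `τ n = T^n (id, 1, 1, …)`. -/
def tau (n : ℤ) : H := (T ^ n) zeroH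

/-! ### The semigroup operation of `𝓗` -/

/-- `(φ ⋆ ψ)_k = ∏_{j=0}^k φ_{k-j} ∘ ψ_j`. -/
def starSeq (φ ψ : ℕ → HT) : ℕ → HT :=
  fun k => ∏ j ∈ Finset.range (k + 1), comp (φ (k - j)) (ψ j)

lemma starSeq_apply (φ ψ : ℕ → HT) (k : ℕ) (x : Circle) :
    (starSeq φ ψ k).1 x = ∏ p ∈ Finset.HasAntidiagonal.antidiagonal k, (φ p.1).1 ((ψ p.2).1 x) := by
  rw [starSeq, coe_prod, ← Finset.Nat.prod_antidiagonal_swap,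
    Finset.Nat.prod_antidiagonal_eq_prod_range_succ_mk]
  rfl

lemma starSeq_mem {φ ψ : ℕ → HT} (hφ : φ ∈ setH) (hψ : ψ ∈ setH) : starSeq φ ψ ∈ setH := by
  rw [mem_setH_iff] at hφ hψ ⊢
  refine ⟨?_, fun k N hN => ?_⟩
  · apply Subtype.ext
    funext x
    rw [starSeq_apply]
    simp [hφ.1, hψ.1, powHom]
  · obtain ⟨m, hm⟩ := hφ.2 k N hN
    obtain ⟨n, hn⟩ := hψ.2 k N hN
    refine ⟨m + n, fun i hi x hx => ?_⟩
    rw [starSeq_apply, Ring.add_choose_eq i (Commute.all m n), ← prod_zpow_eq]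
    refine Finset.prod_congr rfl fun p hp => ?_
    have := Finset.HasAntidiagonal.mem_antidiagonal.mp hp
    rw [hn p.2 (by omega) x hx, hm p.1 (by omega) _ (zpow_torsion hx _), ← zpow_mul, mul_comm]

lemma map_prod' {ι : Type*} (φ : HT) (s : Finset ι) (f : ι → Circle) :
    φ.1 (∏ i ∈ s, f i) = ∏ i ∈ s, φ.1 (f i) :=
  map_prod (toHom φ) f s

lemma starSeq_assoc (φ ψ χ : ℕ → HT) :
    starSeq (starSeq φ ψ) χ = starSeq φ (starSeq ψ χ) := by
  funext k
  apply Subtype.ext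
  funext x
  simp only [starSeq_apply, map_prod', Finset.prod_sigma']
  apply Finset.prod_nbij' (fun ⟨⟨_i, j⟩, ⟨k, l⟩⟩ ↦ ⟨(k, l + j), (l, j)⟩)
    (fun ⟨⟨i, _j⟩, ⟨k, l⟩⟩ ↦ ⟨(i + k, l), (i, k)⟩)
  · rintro ⟨⟨i, j⟩, ⟨a, b⟩⟩ h
    simp only [Finset.mem_sigma, Finset.HasAntidiagonal.mem_antidiagonal] at h ⊢
    obtain ⟨h1, h2⟩ := h
    exact ⟨by omega, trivial⟩
  · rintro ⟨⟨i, j⟩, ⟨a, b⟩⟩ h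
    simp only [Finset.mem_sigma, Finset.HasAntidiagonal.mem_antidiagonal] at h ⊢
    obtain ⟨h1, h2⟩ := h
    exact ⟨by omega, trivial⟩
  · rintro ⟨⟨i, j⟩, ⟨a, b⟩⟩ h
    simp only [Finset.mem_sigma, Finset.HasAntidiagonal.mem_antidiagonal] at h
    simp [h.2]
  · rintro ⟨⟨i, j⟩, ⟨a, b⟩⟩ h
    simp only [Finset.mem_sigma, Finset.HasAntidiagonal.mem_antidiagonal] at h
    simp [h.2]
  · rintro ⟨⟨i, j⟩, ⟨a, b⟩⟩ _
    rfl

lemma zero_starSeq (φ : ℕ → HT) : starSeq zeroSeq φ = φ := by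
  funext k
  apply Subtype.ext
  funext x
  rw [starSeq_apply, Finset.prod_eq_single (0, k)]
  · simp [zeroSeq, powHom]
  · rintro ⟨i, j⟩ hp hne
    have hi : i ≠ 0 := by
      rintro rfl
      simp at hp
      exact hne (by rw [hp])
    simp [zeroSeq, powHom, hi]
  · intro h; simp at h

lemma starSeq_zero (φ : ℕ → HT) : starSeq φ zeroSeq = φ := by
  funext k
  apply Subtype.ext
  funext x
  rw [starSeq_apply, Finset.prod_eq_single (k, 0)]
  · simp [zeroSeq, powHom]
  · rintro ⟨i, j⟩ hp hne
    have hj : j ≠ 0 := by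
      rintro rfl
      simp at hp
      exact hne (by rw [hp])
    have := map_zpow' (φ i) 1 0
    simp only [zpow_zero] at this
    simp [zeroSeq, powHom, hj, this]
  · intro h; simp at h

/-- `𝓗` under `⋆`, with identity `(id, 1, 1, …)`. -/
instance instMonoidH : Monoid H where
  mul φ ψ := ⟨starSeq φ.1 ψ.1, starSeq_mem φ.2 ψ.2⟩
  one := zeroH
  mul_assoc φ ψ χ := Subtype.ext (starSeq_assoc φ.1 ψ.1 χ.1)
  one_mul φ := Subtype.ext (zero_starSeq φ.1)
  mul_one φ := Subtype.ext (starSeq_zero φ.1)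

end WeylSystem

end

noncomputable section

namespace WeylSystem

open scoped BoundedContinuousFunction
open Filter Topology

/-! ### Averages along the natural numbers -/

/-! The orbit of the base point is explicit: `tau n` has `k`-th coordinate `x ↦ x ^ Ring.choose n
k`. By `mem_setH_iff`, a point of `H` is a sequence that on `N`-torsion, in degrees at most `k`,
agrees with some `tau n`; off torsion its coordinates of positive degree vary freely. Hence `H` is
compact, and the product of a point by any sequence in the compact group `trivialOnTorsion` stays in
`H`.

The crux is `denseRange_tau`. Take `g φ = ∏ φ_j(x_j)` and choose `a` such that `tau a` matches `φ`
on the relevant torsion. Average `g` over `tau (a + L t)`, where `L` is divisible enough to freeze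
all torsion data. If every `x_j` with `j > 0` is torsion, `g` is constant along the progression and
on the fibre through `φ`. Otherwise the averages tend to `0` by Weyl's theorem, and so does the Haar
integral vanish, because some endomorphism trivial on torsion moves `x_j`. So orbit averages
converge to fibre integrals on a dense algebra, and a nonnegative function that vanishes on the
orbit cannot be positive at `φ`.

By density, `f ↦ f ∘ tau` is isometric on `C(H, ℂ)`, so its range is closed. Binomial coefficients
span the polynomials, so the products `g` restrict to exactly the polynomial phases; with
Stone–Weierstrass the range is the Weyl algebra (`range_orbitHom`). The spectrum is then that of
`C(H, ℂ)`. The semigroup claims are Vandermonde's identity on torsion and on the orbit. -/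

/-- The average of `u` over `0, …, N - 1`. -/
def avg (u : ℤ → ℂ) (N : ℕ) : ℂ := (∑ n ∈ Finset.range N, u n) / N

lemma avg_add (u v : ℤ → ℂ) (N : ℕ) : avg (fun n => u n + v n) N = avg u N + avg v N := by
  simp [avg, Finset.sum_add_distrib, add_div]

lemma avg_const_mul (c : ℂ) (u : ℤ → ℂ) (N : ℕ) : avg (fun n => c * u n) N = c * avg u N := by
  simp [avg, ← Finset.mul_sum, mul_div_assoc]

lemma avg_sum {ι : Type*} (s : Finset ι) (u : ι → ℤ → ℂ) (N : ℕ) :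
    avg (fun n => ∑ i ∈ s, u i n) N = ∑ i ∈ s, avg (u i) N := by
  simp [avg, Finset.sum_comm (s := Finset.range N), Finset.sum_div]

lemma tendsto_avg_const (c : ℂ) : Tendsto (avg fun _ => c) atTop (𝓝 c) := by
  refine tendsto_const_nhds.congr' ?_
  filter_upwards [eventually_gt_atTop 0] with N hN
  have : (N : ℂ) ≠ 0 := by exact_mod_cast hN.ne'
  simp [avg, mul_comm, this]

lemma norm_avg_le {u : ℤ → ℂ} {C : ℝ} (hC : 0 ≤ C) (h : ∀ n, ‖u n‖ ≤ C) (N : ℕ) :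
    ‖avg u N‖ ≤ C := by
  rcases Nat.eq_zero_or_pos N with rfl | hN
  · simpa [avg] using hC
  · rw [avg, norm_div, Complex.norm_natCast, div_le_iff₀ (by exact_mod_cast hN)]
    calc ‖∑ n ∈ Finset.range N, u n‖ ≤ ∑ n ∈ Finset.range N, ‖u n‖ := norm_sum_le _ _
      _ ≤ ∑ _n ∈ Finset.range N, C := Finset.sum_le_sum fun n _ => h n
      _ = C * N := by simp [mul_comm]

lemma conj_avg (u : ℤ → ℂ) (N : ℕ) :
    avg (fun n => (starRingEnd ℂ) (u n)) N = (starRingEnd ℂ) (avg u N) := by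
  simp [avg]

/-- Cauchy–Schwarz; the mean square is written with a conjugate so that it expands into
correlations. -/
lemma norm_avg_sq_le (u : ℤ → ℂ) (N : ℕ) :
    ‖avg u N‖ ^ 2 ≤ ‖avg (fun n => u n * (starRingEnd ℂ) (u n)) N‖ := by
  rcases Nat.eq_zero_or_pos N with rfl | hN
  · simp [avg]
  · have hN' : (0 : ℝ) < N := by exact_mod_cast hN
    have h1 : ‖∑ n ∈ Finset.range N, u n‖ ^ 2 ≤ N * ∑ n ∈ Finset.range N, ‖u n‖ ^ 2 := by
      calc ‖∑ n ∈ Finset.range N, u n‖ ^ 2 ≤ (∑ n ∈ Finset.range N, ‖u n‖) ^ 2 := by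
            gcongr; exact norm_sum_le _ _
        _ ≤ _ := by simpa using sq_sum_le_card_mul_sum_sq (s := Finset.range N)
                      (f := fun n : ℕ => ‖u n‖)
    have h2 : (∑ n ∈ Finset.range N, u n * (starRingEnd ℂ) (u n))
        = ((∑ n ∈ Finset.range N, ‖u n‖ ^ 2 : ℝ) : ℂ) := by
      simp [Complex.mul_conj']
    rw [avg, avg, h2, norm_div, norm_div, Complex.norm_natCast, Complex.norm_real,
      Real.norm_of_nonneg (Finset.sum_nonneg fun _ _ => by positivity), div_pow, div_le_div_iff₀
      (by positivity) hN']
    nlinarith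

/-- A unit shift changes the sum by two boundary terms only, hence the average by at most `2 / N`.
-/
lemma tendsto_avg_shift_sub {u : ℤ → ℂ} (hu : ∀ n, ‖u n‖ ≤ 1) (h : ℕ) :
    Tendsto (fun N => avg (fun n => u (n + h)) N - avg u N) atTop (𝓝 0) := by
  induction h with
  | zero => simp
  | succ h ih =>
    have key : Tendsto (fun N => avg (fun n => u (n + (h + 1 : ℕ))) N - avg (fun n => u (n + h)) N)
        atTop (𝓝 0) := by
      refine squeeze_zero_norm (a := fun N : ℕ => 2 / (N : ℝ)) (fun N => ?_)
        (tendsto_const_div_atTop_nhds_zero_nat 2)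
      have : ∑ n ∈ Finset.range N, u ((n : ℤ) + (h + 1 : ℕ)) - ∑ n ∈ Finset.range N, u ((n : ℤ) + h)
          = u (N + h) - u h := by
        have := Finset.sum_range_sub (fun n : ℕ => u ((n : ℤ) + h)) N
        rw [← Finset.sum_sub_distrib]
        simp only [Nat.cast_zero, zero_add] at this
        rw [← this]
        refine Finset.sum_congr rfl fun n _ => ?_
        congr 2
        push_cast
        ring
      rw [avg, avg, ← sub_div, this, norm_div, Complex.norm_natCast]
      gcongr
      calc ‖u (N + h) - u h‖ ≤ ‖u (N + h)‖ + ‖u h‖ := norm_sub_le _ _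
        _ ≤ 2 := by linarith [hu (N + h), hu h]
    simpa using key.add ih

/-- Van der Corput's lemma for sequences of modulus one. -/
lemma tendsto_avg_of_vanDerCorput (u : ℤ → Circle)
    (h : ∀ i j : ℕ, i < j →
      Tendsto (avg fun n => ((u (n + j) / u (n + i) : Circle) : ℂ)) atTop (𝓝 0)) :
    Tendsto (avg fun n => (u n : ℂ)) atTop (𝓝 0) := by
  have hcorr : ∀ i j : ℕ, Tendsto (avg fun n => (u (n + j) : ℂ) * (starRingEnd ℂ) (u (n + i) : ℂ))
      atTop (𝓝 (if i = j then 1 else 0)) := by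
    intro i j
    have e : ∀ i j : ℕ, (fun n : ℤ => (u (n + j) : ℂ) * (starRingEnd ℂ) (u (n + i) : ℂ)) =
        fun n => ((u (n + j) / u (n + i) : Circle) : ℂ) := by
      intro i j; funext n
      rw [div_eq_mul_inv, Circle.coe_mul, Circle.coe_inv_eq_conj]
    -- The hypothesis covers `i < j`; the opposite order follows by conjugation.
    rcases lt_trichotomy i j with hij | rfl | hij
    · rw [if_neg hij.ne, e]; exact h i j hij
    · rw [if_pos rfl, e]; simpa using tendsto_avg_const 1
    · rw [if_neg hij.ne']
      have := h j i hij
      rw [← e] at this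
      replace this := (Complex.continuous_conj.tendsto _).comp this
      rw [map_zero] at this
      refine this.congr fun N => ?_
      rw [Function.comp, ← conj_avg]
      congr 1; funext n; simp [mul_comm]
  have hmean : ∀ H : ℕ, 0 < H → ∀ᶠ N in atTop, ‖avg (fun n => (u n : ℂ)) N‖ ^ 2 ≤ 4 * (2 / H) := by
    intro H hH
    have hH' : (0 : ℝ) < H := by exact_mod_cast hH
    have hHc : (H : ℂ) ≠ 0 := by exact_mod_cast hH.ne'
    -- Averaging over a window of length `H` does not affect the limit of the averages of `u`.
    set v : ℤ → ℂ := fun n => (H : ℂ)⁻¹ * ∑ i ∈ Finset.range H, (u (n + i) : ℂ) with hv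
    have h1 : Tendsto (fun N => avg v N - avg (fun n => (u n : ℂ)) N) atTop (𝓝 0) := by
      have : ∀ N, avg v N - avg (fun n => (u n : ℂ)) N = (H : ℂ)⁻¹ * ∑ i ∈ Finset.range H,
          (avg (fun n => (u (n + i) : ℂ)) N - avg (fun n => (u n : ℂ)) N) := by
        intro N
        rw [hv, avg_const_mul, avg_sum, Finset.sum_sub_distrib, mul_sub]
        simp [hHc]
      simp only [this]
      have := (tendsto_finsetSum (Finset.range H) fun i _ =>
        tendsto_avg_shift_sub (u := fun n => (u n : ℂ)) (fun n => (Circle.norm_coe _).le) i).const_mul (H : ℂ)⁻¹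
      simpa using this
    -- Of the `H ^ 2` correlations only the `H` diagonal ones survive, each with limit `1`.
    have h2 : Tendsto (avg fun n => v n * (starRingEnd ℂ) (v n)) atTop (𝓝 (H : ℂ)⁻¹) := by
      have : ∀ n, v n * (starRingEnd ℂ) (v n) = (H : ℂ)⁻¹ * ((H : ℂ)⁻¹ *
          ∑ j ∈ Finset.range H, ∑ i ∈ Finset.range H,
            (u (n + j) : ℂ) * (starRingEnd ℂ) (u (n + i) : ℂ)) := by
        intro n
        rw [hv, ← Finset.sum_mul_sum]
        simp only [map_mul, map_inv₀, Complex.conj_natCast, map_sum]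
        ring
      have e : avg (fun n => v n * (starRingEnd ℂ) (v n)) = fun N => (H : ℂ)⁻¹ * ((H : ℂ)⁻¹ *
          ∑ j ∈ Finset.range H, ∑ i ∈ Finset.range H,
            avg (fun n => (u (n + j) : ℂ) * (starRingEnd ℂ) (u (n + i) : ℂ)) N) := by
        funext N
        simp only [this, avg_const_mul, avg_sum]
      rw [e]
      have := ((tendsto_finsetSum (Finset.range H) fun j _ => tendsto_finsetSum (Finset.range H)
        fun i _ => hcorr i j).const_mul (H : ℂ)⁻¹).const_mul (H : ℂ)⁻¹
      convert this using 2
      have : ∀ j ∈ Finset.range H, (∑ i ∈ Finset.range H, if i = j then (1 : ℂ) else 0) = 1 := by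
        intro j hj
        rw [Finset.sum_ite_eq', if_pos hj]
      rw [Finset.sum_congr rfl this]
      simp [hHc]
    have h3 := h2.norm
    rw [norm_inv, Complex.norm_natCast] at h3
    have h4 : ∀ᶠ N in atTop, ‖avg (fun n => v n * (starRingEnd ℂ) (v n)) N‖ < 2 / H :=
      h3.eventually_lt_const (by rw [inv_eq_one_div]; gcongr; norm_num)
    have h5 := (h1.norm.pow 2).eventually_lt_const (u := 2 / (H : ℝ)) (by simp [hH'])
    filter_upwards [h4, h5] with N h4 h5
    have h6 := (norm_avg_sq_le v N).trans h4.le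
    have h7 : ‖avg (fun n => (u n : ℂ)) N‖ ≤
        ‖avg v N - avg (fun n => (u n : ℂ)) N‖ + ‖avg v N‖ := by
      have := norm_sub_le (avg v N) (avg v N - avg (fun n => (u n : ℂ)) N)
      rw [sub_sub_cancel] at this
      linarith
    have h8 := pow_le_pow_left₀ (norm_nonneg _) h7 2
    -- From `(a + b)² ≤ 2a² + 2b²` with both squares at most `2 / H`.
    nlinarith [sq_nonneg (‖avg v N - avg (fun n => (u n : ℂ)) N‖ - ‖avg v N‖)]
  rw [tendsto_zero_iff_norm_tendsto_zero]
  have : Tendsto (fun N => ‖avg (fun n => (u n : ℂ)) N‖ ^ 2) atTop (𝓝 0) := by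
    rw [Metric.tendsto_atTop']
    intro ε hε
    obtain ⟨H, hH⟩ := exists_nat_gt (8 / ε)
    have hH0 : (0 : ℝ) < H := lt_trans (by positivity) hH
    obtain ⟨N, hN⟩ := (hmean H (by exact_mod_cast hH0)).exists_forall_of_atTop
    refine ⟨N, fun n hn => ?_⟩
    have h1 := hN n hn.le
    rw [dist_zero_right, Real.norm_of_nonneg (by positivity)]
    refine h1.trans_lt ?_
    rw [div_lt_iff₀ hε] at hH
    rw [← mul_div_assoc, div_lt_iff₀ hH0]
    linarith
  have := this.sqrt
  simpa [Real.sqrt_sq] using this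

/-! ### Polynomial sequences in the circle -/

/-- `HasTop d x u`: the `d`-th difference of the sequence `u` is constantly `x`. -/
def HasTop : ℕ → Circle → (ℤ → Circle) → Prop
  | 0, x, u => ∀ n, u n = x
  | d + 1, x, u => HasTop d x fun n => u (n + 1) / u n

lemma HasTop.mul {d : ℕ} {x y : Circle} {u v : ℤ → Circle} (hu : HasTop d x u)
    (hv : HasTop d y v) : HasTop d (x * y) fun n => u n * v n := by
  induction d generalizing u v with
  | zero => intro n; simp only [hu n, hv n]
  | succ d ih =>
    have := ih hu hv
    simpa only [HasTop, mul_div_mul_comm] using this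

lemma HasTop.comp_add {d : ℕ} {x : Circle} {u : ℤ → Circle} (hu : HasTop d x u) (h : ℤ) :
    HasTop d x fun n => u (n + h) := by
  induction d generalizing u with
  | zero => intro n; exact hu _
  | succ d ih =>
    have := ih hu
    simpa only [HasTop, add_right_comm] using this

lemma hasTop_one (d : ℕ) : HasTop d 1 fun _ => 1 := by
  induction d with
  | zero => intro n; rfl
  | succ d ih => simpa only [HasTop, div_self'] using ih

lemma hasTop_const {d : ℕ} (hd : 0 < d) (c : Circle) : HasTop d 1 fun _ => c := by
  obtain ⟨d, rfl⟩ := Nat.exists_eq_succ_of_ne_zero hd.ne'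
  simpa only [HasTop, div_self'] using hasTop_one d

lemma HasTop.succ {d : ℕ} {x : Circle} {u : ℤ → Circle} (hu : HasTop d x u) :
    HasTop (d + 1) 1 u := by
  induction d generalizing u with
  | zero => intro n; simp only [hu n, hu (n + 1), div_self']
  | succ d ih => exact ih hu

lemma HasTop.of_lt {d e : ℕ} {x : Circle} {u : ℤ → Circle} (hu : HasTop d x u) (h : d < e) :
    HasTop e 1 u := by
  induction e, h using Nat.le_induction with
  | base => exact hu.succ
  | succ e _ ih => exact ih.succ

lemma hasTop_prod {ι : Type*} {d : ℕ} (s : Finset ι) {x : ι → Circle} {u : ι → ℤ → Circle}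
    (h : ∀ i ∈ s, HasTop d (x i) (u i)) : HasTop d (∏ i ∈ s, x i) fun n => ∏ i ∈ s, u i n := by
  classical
  induction s using Finset.induction_on with
  | empty => simpa using hasTop_one d
  | insert a s ha ih =>
    simp only [Finset.prod_insert ha]
    exact (h a (Finset.mem_insert_self _ _)).mul
      (ih fun i hi => h i (Finset.mem_insert_of_mem hi))

/-- The quotient telescopes into `h` unit differences, each with top value `x`. -/
lemma HasTop.shift_div {d : ℕ} {x : Circle} {u : ℤ → Circle} (hu : HasTop (d + 1) x u) (h : ℕ) :
    HasTop d (x ^ h) fun n => u (n + h) / u n := by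
  induction h with
  | zero => simpa using hasTop_one d
  | succ h ih =>
    have := ih.mul (HasTop.comp_add (d := d) hu h)
    rw [pow_succ]
    convert this using 2 with n
    rw [mul_comm, div_mul_div_cancel]
    push_cast
    rw [add_assoc]

/-- A unit difference of the new sequence is an `L`-step difference of the old one, so each degree
contributes a factor `L` to the exponent. -/
lemma HasTop.comp_affine {d : ℕ} {x : Circle} {u : ℤ → Circle} (hu : HasTop d x u) (a : ℤ)
    (L : ℕ) : HasTop d (x ^ L ^ d) fun n => u (a + L * n) := by
  induction d generalizing u x with
  | zero => intro n; simpa using hu _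
  | succ d ih =>
    have := ih (hu.shift_div L)
    rw [← pow_mul, ← pow_succ'] at this
    simpa only [HasTop, mul_add, mul_one, add_assoc] using this

lemma hasTop_choose (x : Circle) (k : ℕ) : HasTop k x fun n => x ^ Ring.choose n k := by
  induction k with
  | zero => intro n; simp
  | succ k ih =>
    simpa only [HasTop, Ring.choose_succ_succ, zpow_add, mul_div_cancel_right] using ih

/-- The sequence is geometric with ratio `x ≠ 1`, so its partial sums are bounded by `2 / ‖x - 1‖`.
-/
lemma tendsto_avg_of_hasTop_one {x : Circle} {u : ℤ → Circle} (hx : x ≠ 1) (hu : HasTop 1 x u) :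
    Tendsto (avg fun n => (u n : ℂ)) atTop (𝓝 0) := by
  have h : ∀ n : ℕ, u n = u 0 * x ^ n := by
    intro n
    induction n with
    | zero => simp
    | succ n ih =>
      have := hu n
      rw [div_eq_iff_eq_mul, ih] at this
      push_cast
      rw [this, pow_succ]
      rw [mul_comm x, mul_assoc]
  have hx' : (x : ℂ) - 1 ≠ 0 := by
    rw [sub_ne_zero]
    exact fun h => hx (Circle.ext h)
  refine squeeze_zero_norm (a := fun N : ℕ => (2 / ‖(x : ℂ) - 1‖) / (N : ℝ)) (fun N => ?_)
    (tendsto_const_div_atTop_nhds_zero_nat _)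
  have e : ∑ n ∈ Finset.range N, (u n : ℂ) = u 0 * (((x : ℂ) ^ N - 1) / (x - 1)) := by
    rw [← geom_sum_eq (sub_ne_zero.mp hx'), Finset.mul_sum]
    exact Finset.sum_congr rfl fun n _ => by rw [h n]; simp
  rw [avg, e, norm_div, Complex.norm_natCast, norm_mul, Circle.norm_coe, one_mul, norm_div]
  gcongr
  calc ‖(x : ℂ) ^ N - 1‖ ≤ ‖(x : ℂ) ^ N‖ + ‖(1 : ℂ)‖ := norm_sub_le _ _
    _ = 2 := by rw [norm_pow, Circle.norm_coe, norm_one]; norm_num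

/-- Weyl's theorem on exponential sums with irrational leading coefficient. -/
lemma tendsto_avg_of_hasTop {d : ℕ} {x : Circle} {u : ℤ → Circle}
    (hx : ∀ n : ℕ, 0 < n → x ^ n ≠ 1) (hu : HasTop (d + 1) x u) :
    Tendsto (avg fun n => (u n : ℂ)) atTop (𝓝 0) := by
  induction d generalizing u x with
  | zero => exact tendsto_avg_of_hasTop_one (by simpa using hx 1 one_pos) hu
  | succ d ih =>
    refine tendsto_avg_of_vanDerCorput u fun i j hij => ?_
    -- The quotient has degree one less and top value `x ^ (j - i)`, again of infinite order.
    refine ih (x := x ^ (j - i)) (fun n hn => ?_) ?_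
    · rw [← pow_mul]
      exact hx _ (Nat.mul_pos (by omega) hn)
    · convert (hu.shift_div (j - i)).comp_add i using 4
      push_cast [hij.le]
      ring

/-! ### Compactness of `𝓗` -/

instance compactSpace_HT : CompactSpace HT := by
  have : IsClosed (charGroup Circle : Set (Circle → Circle)) := by
    have e : (charGroup Circle : Set (Circle → Circle)) =
        ⋂ x : Circle, ⋂ y : Circle, {φ | φ (x * y) = φ x * φ y} := by
      ext φ
      simp only [Set.mem_iInter, Set.mem_ofPred_eq]
      rfl
    rw [e]
    exact isClosed_iInter fun x => isClosed_iInter fun y =>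
      isClosed_eq (continuous_apply _) ((continuous_apply x).mul (continuous_apply y))
  exact this.isClosedEmbedding_subtypeVal.compactSpace

lemma continuous_eval_HT (x : Circle) : Continuous fun φ : HT => φ.1 x :=
  (continuous_apply x).comp continuous_subtype_val

lemma finite_torsion {N : ℕ} (hN : 0 < N) : {x : Circle | x ^ N = 1}.Finite := by
  have : NeZero N := ⟨hN.ne'⟩
  refine ((Polynomial.nthRoots N (1 : ℂ)).toFinset.finite_toSet.preimage
    (f := fun x : Circle => (x : ℂ)) (fun x _ y _ h => Circle.ext h)).subset fun x hx => ?_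
  simp only [Set.mem_preimage, SetLike.mem_coe, Multiset.mem_toFinset, Polynomial.mem_nthRoots hN]
  exact_mod_cast congrArg (fun y : Circle => (y : ℂ)) hx

/-- For fixed `k` and `N` the condition involves finitely many coordinates, and the admissible
patterns form a finite set because `N`-torsion is finite; it is thus the preimage of a finite set
under a continuous map. -/
lemma isClosed_setH : IsClosed setH := by
  have e : setH = {φ | φ 0 = powHom 1} ∩ ⋂ k : ℕ, ⋂ N : ℕ, ⋂ _ : 0 < N,
      {φ : ℕ → HT | ∃ n : ℤ, ∀ i ≤ k, ∀ x : Circle, x ^ N = 1 →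
        (φ i).1 x = x ^ Ring.choose n i} := by
    ext φ
    simp only [mem_setH_iff, Set.mem_inter_iff, Set.mem_iInter, Set.mem_ofPred_eq]
  rw [e]
  refine (isClosed_eq (continuous_apply 0) continuous_const).inter
    (isClosed_iInter fun k => isClosed_iInter fun N => isClosed_iInter fun hN => ?_)
  have hfin := finite_torsion hN
  have : Finite {x : Circle | x ^ N = 1} := hfin
  let r : (ℕ → HT) → (Fin (k + 1) × {x : Circle | x ^ N = 1} → Circle) :=
    fun φ p => (φ p.1).1 p.2
  let s : ℤ → (Fin (k + 1) × {x : Circle | x ^ N = 1} → Circle) :=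
    fun n p => (p.2 : Circle) ^ Ring.choose n (p.1 : ℕ)
  have hr : Continuous r := continuous_pi fun p =>
    (continuous_eval_HT _).comp (continuous_apply _)
  have hs : (Set.range s).Finite := by
    refine (Set.Finite.pi' (fun _ : Fin (k + 1) × {x : Circle | x ^ N = 1} => hfin)).subset ?_
    rintro _ ⟨n, rfl⟩ p
    exact zpow_torsion p.2.2 _
  convert hs.isClosed.preimage hr using 1
  ext φ
  simp only [Set.mem_ofPred_eq, Set.mem_preimage, Set.mem_range]
  refine exists_congr fun n => ⟨fun h => ?_, fun h i hi x hx => ?_⟩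
  · funext p
    exact (h p.1 (by omega) p.2 p.2.2).symm
  · exact (congrFun h (⟨i, by omega⟩, ⟨x, hx⟩)).symm

instance compactSpace_H : CompactSpace H := isClosed_setH.isClosedEmbedding_subtypeVal.compactSpace

/-! ### The sequence `τ` -/

lemma powHom_mul (m n : ℤ) : powHom m * powHom n = powHom (m + n) :=
  Subtype.ext (funext fun x => (zpow_add x m n).symm)

lemma shiftMul_choose (n : ℤ) :
    shiftMul (fun k => powHom (Ring.choose n k)) = fun k => powHom (Ring.choose (n + 1) k) := by
  funext k
  cases k with
  | zero => simp [shiftMul]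
  | succ k => rw [shiftMul, powHom_mul, Ring.choose_succ_succ]

lemma tau_add_one (n : ℤ) : tau (n + 1) = T (tau n) := by
  rw [tau, add_comm, zpow_add, zpow_one]
  rfl

lemma tau_val (n : ℤ) : (tau n).1 = fun k => powHom (Ring.choose n k) := by
  have h0 : (tau 0).1 = fun k => powHom (Ring.choose 0 k) := by
    funext k
    rw [Ring.choose_zero_ite]
    show zeroSeq k = _
    unfold zeroSeq
    split_ifs <;> rfl
  have hT (n : ℤ) : (tau (n + 1)).1 = shiftMul (tau n).1 := by rw [tau_add_one]; rfl
  induction n using Int.induction_on with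
  | zero => exact h0
  | succ n ih => rw [hT, ih, shiftMul_choose]
  | pred n ih =>
    have h := hT (-n - 1)
    have h' := shiftMul_choose (-n - 1)
    rw [sub_add_cancel, ← ih] at h'
    rw [sub_add_cancel, ← h'] at h
    rw [← shiftMulInv_mul (tau (-n - 1)).1, ← h, shiftMulInv_mul]

lemma tau_apply (n : ℤ) (k : ℕ) (x : Circle) : ((tau n).1 k).1 x = x ^ Ring.choose n k := by
  rw [tau_val]; rfl

/-! ### The continuous functions `φ ↦ ∏ φ_j(x_j)` on `𝓗` -/

/-- The function `φ ↦ φ_k(x)`. -/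
def evalC (k : ℕ) (x : Circle) : C(H, ℂ) where
  toFun φ := (φ.1 k).1 x
  continuous_toFun := continuous_subtype_val.comp
    ((continuous_eval_HT x).comp ((continuous_apply k).comp continuous_subtype_val))

/-- The multiplicative monoid generated by the functions `φ ↦ φ_k(x)`. -/
def charMonoid : Submonoid C(H, ℂ) :=
  Submonoid.closure (Set.range fun p : ℕ × Circle => evalC p.1 p.2)

lemma evalC_mem (k : ℕ) (x : Circle) : evalC k x ∈ charMonoid :=
  Submonoid.subset_closure ⟨(k, x), rfl⟩

lemma map_one' (φ : HT) : φ.1 1 = 1 := map_one (toHom φ)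

/-- Allowing every length `k ≥ K` brings two such products to a common length before they are
multiplied. -/
lemma exists_prod_of_mem_charMonoid {χ : C(H, ℂ)} (hχ : χ ∈ charMonoid) :
    ∃ (K : ℕ) (x : ℕ → Circle), ∀ k, K ≤ k → ∀ φ : H,
      χ φ = ((∏ j ∈ Finset.range k, (φ.1 j).1 (x j) : Circle) : ℂ) := by
  induction hχ using Submonoid.closure_induction with
  | mem χ h =>
    obtain ⟨⟨i, y⟩, rfl⟩ := h
    refine ⟨i + 1, Pi.mulSingle i y, fun k hk φ => ?_⟩
    rw [Finset.prod_eq_single i]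
    · simp [evalC]
    · intro j _ hj
      rw [Pi.mulSingle_eq_of_ne hj, map_one']
    · intro h
      exact absurd (Finset.mem_range.mpr (by omega)) h
  | one =>
    refine ⟨0, fun _ => 1, fun k _ φ => ?_⟩
    simp [map_one']
  | mul a b _ _ ha hb =>
    obtain ⟨K, x, hx⟩ := ha
    obtain ⟨K', x', hx'⟩ := hb
    refine ⟨max K K', fun j => x j * x' j, fun k hk φ => ?_⟩
    rw [ContinuousMap.mul_apply, hx k (by omega), hx' k (by omega), ← Circle.coe_mul,
      ← Finset.prod_mul_distrib]
    simp only [(φ.1 _).2 _ _]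

lemma star_mem_charMonoid {χ : C(H, ℂ)} (hχ : χ ∈ charMonoid) : star χ ∈ charMonoid := by
  induction hχ using Submonoid.closure_induction with
  | mem χ h =>
    obtain ⟨⟨i, y⟩, rfl⟩ := h
    convert evalC_mem i y⁻¹ using 1
    ext φ
    have : (φ.1 i).1 y⁻¹ = ((φ.1 i).1 y)⁻¹ := map_inv (toHom (φ.1 i)) y
    simp only [evalC, ContinuousMap.star_apply, ContinuousMap.coe_mk, this,
      Circle.coe_inv_eq_conj]
    rfl
  | one => rw [star_one]; exact one_mem _
  | mul a b _ _ ha hb => rw [star_mul]; exact mul_mem hb ha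

/-- The linear span of `charMonoid`, a star subalgebra. -/
def charAlgebra : StarSubalgebra ℂ C(H, ℂ) where
  toSubalgebra := Algebra.adjoin ℂ charMonoid
  star_mem' {f} hf := by
    change f ∈ Algebra.adjoin ℂ (charMonoid : Set C(H, ℂ)) at hf
    change star f ∈ Algebra.adjoin ℂ (charMonoid : Set C(H, ℂ))
    induction hf using Algebra.adjoin_induction with
    | mem x hx => exact Algebra.subset_adjoin (star_mem_charMonoid hx)
    | algebraMap r =>
      rw [← algebraMap_star_comm]
      exact Subalgebra.algebraMap_mem _ _
    | add x y _ _ hx hy => rw [star_add]; exact add_mem hx hy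
    | mul x y _ _ hx hy => rw [star_mul]; exact mul_mem hy hx

lemma mem_charAlgebra {f : C(H, ℂ)} :
    f ∈ charAlgebra ↔ f ∈ Submodule.span ℂ (charMonoid : Set C(H, ℂ)) := by
  have := Algebra.adjoin_eq_span ℂ (charMonoid : Set C(H, ℂ))
  rw [Submonoid.closure_eq] at this
  rw [← this]
  rfl

lemma dense_charAlgebra : Dense (charAlgebra : Set C(H, ℂ)) := by
  have h := ContinuousMap.starSubalgebra_topologicalClosure_eq_top_of_separatesPoints charAlgebra ?_
  · intro f
    have : f ∈ charAlgebra.topologicalClosure := h ▸ StarSubalgebra.mem_top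
    exact this
  · intro φ ψ hne
    obtain ⟨k, x, hx⟩ : ∃ k x, (φ.1 k).1 x ≠ (ψ.1 k).1 x := by
      by_contra! h
      exact hne (Subtype.ext (funext fun k => Subtype.ext (funext fun x => h k x)))
    exact ⟨evalC k x, ⟨evalC k x, Algebra.subset_adjoin (evalC_mem k x), rfl⟩,
      fun h => hx (Circle.ext h)⟩

/-! ### The compact group acting on the fibres of `𝓗` over the torsion data -/

/-- The sequences in `H(𝕋)` that are trivial in degree zero and on all roots of unity. -/
def trivialOnTorsion : Subgroup (ℕ → HT) where
  carrier := {δ | δ 0 = 1 ∧ ∀ k N : ℕ, 0 < N → ∀ x : Circle, x ^ N = 1 → (δ k).1 x = 1}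
  mul_mem' {a b} ha hb := ⟨by rw [Pi.mul_apply, ha.1, hb.1, one_mul], fun k N hN x hx => by
    rw [Pi.mul_apply, coe_mul_apply, ha.2 k N hN x hx, hb.2 k N hN x hx, one_mul]⟩
  one_mem' := ⟨rfl, fun _ _ _ _ _ => rfl⟩
  inv_mem' {a} ha := ⟨by rw [Pi.inv_apply, ha.1, inv_one], fun k N hN x hx => by
    have : ((a⁻¹) k).1 x = ((a k).1 x)⁻¹ := rfl
    rw [this, ha.2 k N hN x hx, inv_one]⟩

instance compactSpace_trivialOnTorsion : CompactSpace trivialOnTorsion := by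
  have : IsClosed (trivialOnTorsion : Set (ℕ → HT)) := by
    have e : (trivialOnTorsion : Set (ℕ → HT)) = {δ | δ 0 = 1} ∩
        ⋂ k : ℕ, ⋂ N : ℕ, ⋂ _ : 0 < N, ⋂ x : Circle, ⋂ _ : x ^ N = 1, {δ | (δ k).1 x = 1} := by
      ext δ
      simp only [Set.mem_inter_iff, Set.mem_iInter, Set.mem_ofPred_eq]
      rfl
    rw [e]
    exact (isClosed_eq (continuous_apply 0) continuous_const).inter
      (isClosed_iInter fun k => isClosed_iInter fun N => isClosed_iInter fun _ =>
        isClosed_iInter fun x => isClosed_iInter fun _ =>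
          isClosed_eq ((continuous_eval_HT x).comp (continuous_apply k)) continuous_const)
  exact this.isClosedEmbedding_subtypeVal.compactSpace

instance measurableSpace_trivialOnTorsion : MeasurableSpace trivialOnTorsion := borel _

instance borelSpace_trivialOnTorsion : BorelSpace trivialOnTorsion := ⟨rfl⟩

/-- Multiplication of a point of `𝓗` by a sequence trivial on torsion. -/
def translate (φ : H) (δ : trivialOnTorsion) : H := ⟨φ.1 * δ.1, by
  have h := (mem_setH_iff _).mp φ.2
  refine (mem_setH_iff _).mpr ⟨?_, fun k N hN => ?_⟩
  · rw [Pi.mul_apply, h.1, δ.2.1, mul_one]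
  · obtain ⟨n, hn⟩ := h.2 k N hN
    refine ⟨n, fun i hi x hx => ?_⟩
    rw [Pi.mul_apply, coe_mul_apply, hn i hi x hx, δ.2.2 i N hN x hx, mul_one]⟩

lemma continuous_translate (φ : H) : Continuous (translate φ) :=
  (continuous_const.mul continuous_subtype_val).subtype_mk _

lemma translate_one (φ : H) : translate φ 1 = φ := Subtype.ext (mul_one φ.1)

/-- Endomorphisms of the circle that are trivial on torsion separate non-torsion points from `1`. -/
lemma exists_trivialOnTorsion_ne_one {x : Circle} (hx : ∀ n : ℕ, 0 < n → x ^ n ≠ 1) :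
    ∃ ψ : HT, (∀ N : ℕ, 0 < N → ∀ y : Circle, y ^ N = 1 → ψ.1 y = 1) ∧ ψ.1 x ≠ 1 := by
  -- A character factoring through the quotient by torsion is trivial on torsion, and `x` survives
  -- in that quotient.
  let q : Circle →* Circle ⧸ CommGroup.torsion Circle := QuotientGroup.mk' _
  have hq : Additive.ofMul (q x) ≠ 0 := by
    intro h
    have h1 : q x = 1 := h
    rw [QuotientGroup.mk'_apply, QuotientGroup.eq_one_iff] at h1
    obtain ⟨n, hn, hxn⟩ := isOfFinOrder_iff_pow_eq_one.mp h1
    exact hx n hn hxn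
  -- Characters into `ℚ/ℤ` separate points; `ℚ/ℤ` is then embedded in the circle by `j`.
  obtain ⟨c, hc⟩ := CharacterModule.exists_character_apply_ne_zero_of_ne_zero hq
  let e : ℚ →+ Additive Circle :=
    { toFun := fun r => Additive.ofMul (Circle.exp (2 * Real.pi * (r : ℝ)))
      map_zero' := by simp
      map_add' := fun r s => by
        rw [Rat.cast_add, mul_add, Circle.exp_add]; rfl }
  have he : ∀ r, e r = 0 ↔ r ∈ AddSubgroup.zmultiples (1 : ℚ) := by
    intro r
    have : e r = 0 ↔ Circle.exp (2 * Real.pi * (r : ℝ)) = 1 := Iff.rfl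
    rw [this, Circle.exp_eq_one, AddSubgroup.mem_zmultiples_iff]
    refine exists_congr fun n => ?_
    rw [mul_comm (n : ℝ), mul_right_inj' (by positivity), zsmul_one]
    constructor
    · intro h; exact_mod_cast h.symm
    · intro h; exact_mod_cast h.symm
  let j : AddCircle (1 : ℚ) →+ Additive Circle :=
    QuotientAddGroup.lift _ e fun r hr => (he r).mpr hr
  have hj : ∀ a, j a = 0 → a = 0 := by
    intro a ha
    induction a using QuotientAddGroup.induction_on with
    | H r => exact (QuotientAddGroup.eq_zero_iff r).mpr ((he r).mp ha)
  let c' : Additive (Circle ⧸ CommGroup.torsion Circle) →+ AddCircle (1 : ℚ) := c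
  let ψ : Circle →* Circle := (AddMonoidHom.toMultiplicative (j.comp c')).comp q
  refine ⟨⟨ψ, ψ.map_mul⟩, fun N hN y hy => ?_, fun h => hc (hj _ h)⟩
  have : q y = 1 := by
    rw [QuotientGroup.mk'_apply, QuotientGroup.eq_one_iff]
    exact isOfFinOrder_iff_pow_eq_one.mpr ⟨N, hN, hy⟩
  exact (congrArg (fun z => j (c' (Additive.ofMul z))) this).trans (j.comp c').map_zero

/-! ### Density of the orbit -/

/-- `j! * Ring.choose n j` is an integer polynomial in `n`, so it changes by a multiple of `m * k!`;
cancelling `j!`, a divisor of `k!`, leaves a multiple of `m`. -/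
lemma dvd_choose_sub_choose {j k m : ℕ} (hjk : j ≤ k) (a t : ℤ) :
    (m : ℤ) ∣ Ring.choose (a + (m * k.factorial : ℕ) * t) j - Ring.choose a j := by
  have e : ∀ n : ℤ, (descPochhammer ℤ j).eval n = j.factorial * Ring.choose n j := fun n => by
    rw [Polynomial.eval_eq_smeval, Ring.descPochhammer_eq_factorial_smul_choose, nsmul_eq_mul]
  obtain ⟨c, hc⟩ := Nat.factorial_dvd_factorial hjk
  have h := Polynomial.sub_dvd_eval_sub (a + (m * k.factorial : ℕ) * t) a (descPochhammer ℤ j)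
  rw [e, e, ← mul_sub, add_sub_cancel_left] at h
  have h0 : (j.factorial : ℤ) ≠ 0 := by exact_mod_cast j.factorial_ne_zero
  refine (mul_dvd_mul_iff_left h0).mp (dvd_trans ⟨c * t, ?_⟩ h)
  rw [hc]
  push_cast
  ring

lemma zpow_choose_add {j k m : ℕ} (hjk : j ≤ k) {x : Circle} (hx : x ^ m = 1) (a t : ℤ) :
    x ^ Ring.choose (a + (m * k.factorial : ℕ) * t) j = x ^ Ring.choose a j := by
  obtain ⟨c, hc⟩ := dvd_choose_sub_choose (m := m) hjk a t
  rw [sub_eq_iff_eq_add.mp hc, zpow_add, zpow_mul, zpow_natCast, hx, one_zpow, one_mul]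

lemma apply_zero (φ : H) (x : Circle) : (φ.1 0).1 x = x := by
  rw [φ.2.1]; exact zpow_one x

/-- A bound for the orders of finitely many points, ignoring those of infinite order. -/
lemma exists_common_order (x : ℕ → Circle) (K : ℕ) :
    ∃ M : ℕ, 0 < M ∧ ∀ j < K, IsOfFinOrder (x j) → x j ^ M = 1 := by
  have : ∀ j, ∃ N : ℕ, 0 < N ∧ (IsOfFinOrder (x j) → x j ^ N = 1) := fun j => by
    by_cases h : IsOfFinOrder (x j)
    · obtain ⟨N, hN, h1⟩ := isOfFinOrder_iff_pow_eq_one.mp h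
      exact ⟨N, hN, fun _ => h1⟩
    · exact ⟨1, one_pos, fun h' => absurd h' h⟩
  choose N hN h1 using this
  refine ⟨∏ j ∈ Finset.range K, N j, Finset.prod_pos fun j _ => hN j, fun j hj h => ?_⟩
  obtain ⟨c, hc⟩ := Finset.dvd_prod_of_mem N (Finset.mem_range.mpr hj)
  rw [hc, pow_mul, h1 j h, one_pow]

open MeasureTheory

lemma integrable_translate (ν : Measure trivialOnTorsion) [IsFiniteMeasure ν]
    (φ : H) (g : C(H, ℂ)) : Integrable (fun δ => g (translate φ δ)) ν :=
  (g.continuous.comp (continuous_translate φ)).integrable_of_hasCompactSupport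
    (HasCompactSupport.of_compactSpace _)

/-- `AvgTendsto ν φ g`: the averages of `g` over suitable arithmetic progressions in the orbit tend
to the integral of `g` over the fibre through `φ`. -/
def AvgTendsto (ν : Measure trivialOnTorsion) (φ : H) (g : C(H, ℂ)) : Prop :=
  ∃ M K : ℕ, 0 < M ∧ ∀ m k : ℕ, 0 < m → M ∣ m → K ≤ k → ∀ a : ℤ,
    (∀ i ≤ k, ∀ x : Circle, x ^ m = 1 → (φ.1 i).1 x = x ^ Ring.choose a i) →
    Tendsto (avg fun t => g (tau (a + (m * k.factorial : ℕ) * t))) atTop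
      (𝓝 (∫ δ, g (translate φ δ) ∂ν))

lemma AvgTendsto.add {ν : Measure trivialOnTorsion} [IsFiniteMeasure ν] {φ : H} {f g : C(H, ℂ)}
    (hf : AvgTendsto ν φ f) (hg : AvgTendsto ν φ g) : AvgTendsto ν φ (f + g) := by
  obtain ⟨M, K, hM, h⟩ := hf
  obtain ⟨M', K', hM', h'⟩ := hg
  -- All multiples of `M` and all `k ≥ K` are admitted in `AvgTendsto` so that two functions can be
  -- averaged along one progression.
  refine ⟨M * M', max K K', Nat.mul_pos hM hM', fun m k hm hd hk a ha => ?_⟩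
  have := (h m k hm (dvd_of_mul_right_dvd hd) (by omega) a ha).add
    (h' m k hm (dvd_of_mul_left_dvd hd) (by omega) a ha)
  rw [← integral_add (integrable_translate ν φ f) (integrable_translate ν φ g)] at this
  refine this.congr fun N => ?_
  rw [← avg_add]
  rfl

lemma AvgTendsto.smul {ν : Measure trivialOnTorsion} {φ : H} {g : C(H, ℂ)}
    (hg : AvgTendsto ν φ g) (c : ℂ) : AvgTendsto ν φ (c • g) := by
  obtain ⟨M, K, hM, h⟩ := hg
  refine ⟨M, K, hM, fun m k hm hd hk a ha => ?_⟩
  have := (h m k hm hd hk a ha).const_mul c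
  rw [← integral_const_mul] at this
  refine this.congr fun N => ?_
  rw [← avg_const_mul]
  rfl

/-- Translation by an element concentrated in degree `j` preserves the integral but multiplies it by
`ψ (x j) ≠ 1`. Degree zero is excluded because elements of `trivialOnTorsion` are trivial there. -/
lemma integral_translate_eq_zero (ν : Measure trivialOnTorsion) [ν.IsMulLeftInvariant] (φ : H)
    {χ : C(H, ℂ)} {K : ℕ} {x : ℕ → Circle}
    (hχ : ∀ φ : H, χ φ = ((∏ j ∈ Finset.range K, (φ.1 j).1 (x j) : Circle) : ℂ))
    {j : ℕ} (hj : 0 < j) (hjK : j < K) (hx : ¬ IsOfFinOrder (x j)) :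
    ∫ δ, χ (translate φ δ) ∂ν = 0 := by
  obtain ⟨ψ, hψ, hne⟩ := exists_trivialOnTorsion_ne_one (x := x j) (by
    simpa [isOfFinOrder_iff_pow_eq_one] using hx)
  let δ₀ : trivialOnTorsion := ⟨Pi.mulSingle j ψ, by
    refine ⟨Pi.mulSingle_eq_of_ne hj.ne _, fun k N hN y hy => ?_⟩
    rcases eq_or_ne k j with rfl | h
    · rw [Pi.mulSingle_eq_same]; exact hψ N hN y hy
    · rw [Pi.mulSingle_eq_of_ne h]; rfl⟩
  have e : ∀ δ, χ (translate φ (δ₀ * δ)) = (ψ.1 (x j) : ℂ) * χ (translate φ δ) := by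
    intro δ
    have h1 : ∏ i ∈ Finset.range K, (δ₀.1 i).1 (x i) = ψ.1 (x j) := by
      rw [Finset.prod_eq_single j]
      · show ((Pi.mulSingle j ψ : ℕ → HT) j).1 (x j) = _
        rw [Pi.mulSingle_eq_same]
      · intro i _ hi
        show ((Pi.mulSingle j ψ : ℕ → HT) i).1 (x i) = _
        rw [Pi.mulSingle_eq_of_ne hi]; rfl
      · intro h
        exact absurd (Finset.mem_range.mpr hjK) h
    rw [hχ, hχ, ← Circle.coe_mul, ← h1, ← Finset.prod_mul_distrib]
    congr 1
    refine Finset.prod_congr rfl fun i _ => ?_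
    show (φ.1 i).1 (x i) * ((δ₀.1 i).1 (x i) * (δ.1 i).1 (x i)) =
      (δ₀.1 i).1 (x i) * ((φ.1 i).1 (x i) * (δ.1 i).1 (x i))
    exact mul_left_comm _ _ _
  have h := integral_mul_left_eq_self (μ := ν) (fun δ => χ (translate φ δ)) δ₀
  simp only [e] at h
  rw [integral_const_mul] at h
  have h2 : ((ψ.1 (x j) : ℂ) - 1) * ∫ δ, χ (translate φ δ) ∂ν = 0 := by rw [sub_mul, h]; ring
  rcases mul_eq_zero.mp h2 with h3 | h3
  · exact absurd (Circle.ext (sub_eq_zero.mp h3)) hne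
  · exact h3

lemma avgTendsto_of_mem_charMonoid (ν : Measure trivialOnTorsion) [ν.IsMulLeftInvariant]
    [IsProbabilityMeasure ν] (φ : H) {χ : C(H, ℂ)} (hχ : χ ∈ charMonoid) : AvgTendsto ν φ χ := by
  obtain ⟨K, x, hx⟩ := exists_prod_of_mem_charMonoid hχ
  replace hx := hx K le_rfl
  obtain ⟨M, hM, hord⟩ := exists_common_order x K
  refine ⟨M, K, hM, fun m k hm hd hk a ha => ?_⟩
  have hord' : ∀ j < K, IsOfFinOrder (x j) → x j ^ m = 1 := fun j hj h => by
    obtain ⟨c, rfl⟩ := hd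
    rw [pow_mul, hord j hj h, one_pow]
  -- The point `x 0` plays no role, since the coordinate of degree zero is the identity throughout
  -- `H`.
  by_cases htor : ∀ j < K, 0 < j → IsOfFinOrder (x j)
  · have h1 : ∀ t : ℤ, χ (tau (a + (m * k.factorial : ℕ) * t)) = χ φ := fun t => by
      rw [hx, hx]
      congr 1
      refine Finset.prod_congr rfl fun j hj => ?_
      have hj := Finset.mem_range.mp hj
      rcases Nat.eq_zero_or_pos j with rfl | hj0
      · rw [apply_zero, apply_zero]
      · have ho := hord' j hj (htor j hj hj0)
        rw [tau_apply, ha j (by omega) _ ho, zpow_choose_add (by omega) ho]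
    have h2 : ∀ δ, χ (translate φ δ) = χ φ := fun δ => by
      rw [hx, hx]
      congr 1
      refine Finset.prod_congr rfl fun j hj => ?_
      have hj := Finset.mem_range.mp hj
      rcases Nat.eq_zero_or_pos j with rfl | hj0
      · rw [apply_zero, apply_zero]
      · show (φ.1 j).1 (x j) * (δ.1 j).1 (x j) = _
        rw [δ.2.2 j m hm _ (hord' j hj (htor j hj hj0)), mul_one]
    simp only [h1, h2, integral_const, probReal_univ, one_smul]
    exact tendsto_avg_const _
  · classical
    push Not at htor
    obtain ⟨i, hiK, hi0, hi⟩ := htor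
    -- At the largest degree `j` with `x j` of infinite order, factors of higher degree are constant
    -- along the progression and those of lower degree die after `j` differences.
    obtain ⟨j, hj, hmax⟩ := Finset.exists_max_image
      ((Finset.range K).filter fun j => 0 < j ∧ ¬ IsOfFinOrder (x j)) id
      ⟨i, by simp [hiK, hi0, hi]⟩
    simp only [Finset.mem_filter, Finset.mem_range, id] at hj hmax
    obtain ⟨hjK, hj0, hxj⟩ := hj
    rw [integral_translate_eq_zero ν φ hx hj0 hjK hxj]
    set L : ℕ := m * k.factorial with hL
    have hLpos : 0 < L := Nat.mul_pos hm k.factorial_pos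
    have hfac : ∀ i ∈ Finset.range K, HasTop j (if i = j then x j ^ L ^ j else 1)
        fun t => x i ^ Ring.choose (a + L * t) i := by
      intro i hi
      rw [Finset.mem_range] at hi
      split_ifs with hij
      · subst hij
        exact (hasTop_choose (x i) i).comp_affine a L
      · rcases lt_or_gt_of_ne hij with h | h
        · exact ((hasTop_choose (x i) i).comp_affine a L).of_lt h
        · have ho : IsOfFinOrder (x i) := by
            by_contra hno
            have := hmax i ⟨hi, by omega, hno⟩
            omega
          simp only [hL, zpow_choose_add (show i ≤ k by omega) (hord' i hi ho)]
          exact hasTop_const hj0 _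
    have htop := hasTop_prod (Finset.range K) hfac
    rw [Finset.prod_ite_eq' , if_pos (Finset.mem_range.mpr hjK)] at htop
    obtain ⟨d, rfl⟩ := Nat.exists_eq_succ_of_ne_zero hj0.ne'
    -- The top value is a positive power of `x j`, hence of infinite order.
    have := tendsto_avg_of_hasTop (fun n hn h => hxj (isOfFinOrder_iff_pow_eq_one.mpr
      ⟨L ^ (d + 1) * n, by positivity, by rw [pow_mul]; exact h⟩)) htop
    refine this.congr fun N => ?_
    congr 1
    funext t
    rw [hx]
    congr 1
    exact Finset.prod_congr rfl fun i _ => (tau_apply _ _ _).symm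

lemma avgTendsto_of_mem_charAlgebra (ν : Measure trivialOnTorsion) [ν.IsMulLeftInvariant]
    [IsProbabilityMeasure ν] (φ : H) {g : C(H, ℂ)} (hg : g ∈ charAlgebra) : AvgTendsto ν φ g := by
  rw [mem_charAlgebra] at hg
  induction hg using Submodule.span_induction with
  | mem χ hχ => exact avgTendsto_of_mem_charMonoid ν φ hχ
  | zero =>
    have := (avgTendsto_of_mem_charMonoid ν φ charMonoid.one_mem).smul 0
    rwa [zero_smul] at this
  | add f g _ _ hf hg => exact hf.add hg
  | smul c g _ hg => exact hg.smul c

theorem denseRange_tau : DenseRange tau := by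
  intro φ
  by_contra hφ
  obtain ⟨f, hf0, hf1, hf⟩ := exists_continuous_zero_one_of_isClosed
    (isClosed_closure (s := Set.range tau)) (isClosed_singleton (x := φ))
    (Set.disjoint_singleton_right.mpr hφ)
  let ν : Measure trivialOnTorsion := Measure.haarMeasure ⊤
  have : IsProbabilityMeasure ν := ⟨Measure.haarMeasure_self⟩
  have hfc : Continuous fun δ => f (translate φ δ) := f.continuous.comp (continuous_translate φ)
  set c : ℝ := ∫ δ, f (translate φ δ) ∂ν with hc
  -- The integrand is continuous, nonnegative and equal to `1` at the identity, and Haar measure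
  -- charges open sets.
  have hcpos : 0 < c := by
    refine hfc.integral_pos_of_hasCompactSupport_nonneg_nonzero
      (HasCompactSupport.of_compactSpace _) (fun δ => (hf _).1) (x := 1) ?_
    rw [translate_one, hf1 rfl]
    exact one_ne_zero
  let F : C(H, ℂ) := ⟨fun ψ => (f ψ : ℂ), Complex.continuous_ofReal.comp f.continuous⟩
  have hFc : ∫ δ, F (translate φ δ) ∂ν = (c : ℂ) := integral_ofReal
  obtain ⟨g, hg, hdist⟩ := dense_charAlgebra.exists_dist_lt F (half_pos hcpos)
  rw [dist_eq_norm] at hdist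
  obtain ⟨M, K, hM, h⟩ := avgTendsto_of_mem_charAlgebra ν φ hg
  obtain ⟨a, ha⟩ := ((mem_setH_iff _).mp φ.2).2 K M hM
  have hlim := h M K hM dvd_rfl le_rfl a ha
  -- `F` vanishes on the orbit, so there `g` is bounded by `‖F - g‖ < c / 2`. Together with `h2`
  -- this gives `c ≤ 2 * ‖F - g‖ < c`.
  have h1 : ‖∫ δ, g (translate φ δ) ∂ν‖ ≤ ‖F - g‖ := by
    refine le_of_tendsto hlim.norm (Eventually.of_forall fun N => ?_)
    refine norm_avg_le (norm_nonneg _) (fun t => ?_) N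
    have h2 := (F - g).norm_coe_le_norm (tau (a + (M * K.factorial : ℕ) * t))
    have h3 : F (tau (a + (M * K.factorial : ℕ) * t)) = 0 := by
      show ((f _ : ℝ) : ℂ) = 0
      rw [hf0 (subset_closure ⟨_, rfl⟩)]
      simp
    rwa [ContinuousMap.sub_apply, h3, zero_sub, norm_neg] at h2
  have h2 : ‖(c : ℂ) - ∫ δ, g (translate φ δ) ∂ν‖ ≤ ‖F - g‖ := by
    rw [← hFc, ← integral_sub (integrable_translate ν φ F) (integrable_translate ν φ g)]
    refine (norm_integral_le_of_norm_le_const (C := ‖F - g‖) (Eventually.of_forall fun δ =>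
      (F - g).norm_coe_le_norm (translate φ δ))).trans_eq ?_
    rw [probReal_univ, mul_one]
  have h3 : ‖(c : ℂ)‖ = c := by rw [Complex.norm_real, Real.norm_of_nonneg hcpos.le]
  have h4 := norm_add_le ((c : ℂ) - ∫ δ, g (translate φ δ) ∂ν) (∫ δ, g (translate φ δ) ∂ν)
  rw [sub_add_cancel, h3] at h4
  linarith

/-! ### The representation of `C(𝓗)` on bounded sequences -/

/-- The representation `f ↦ f ∘ τ` of `C(𝓗)`, as a star homomorphism. -/
def orbitHom : C(H, ℂ) →⋆ₐ[ℂ] LInfty where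
  toFun f := pullback tau (BoundedContinuousFunction.mkOfCompact f)
  map_one' := rfl
  map_mul' _ _ := rfl
  map_zero' := rfl
  map_add' _ _ := rfl
  commutes' _ := rfl
  map_star' _ := rfl

lemma orbitHom_apply (f : C(H, ℂ)) (n : ℤ) : orbitHom f n = f (tau n) := rfl

/-- Density of the orbit makes the supremum over it the full norm. -/
lemma norm_orbitHom (f : C(H, ℂ)) : ‖orbitHom f‖ = ‖f‖ := by
  refine le_antisymm (lp.norm_le_of_forall_le (norm_nonneg _) fun n => f.norm_coe_le_norm _) ?_
  rw [ContinuousMap.norm_le _ (norm_nonneg _)]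
  intro φ
  refine denseRange_tau.induction_on φ
    (isClosed_le (by fun_prop) continuous_const) fun n => ?_
  exact lp.norm_apply_le_norm (by simp) (orbitHom f) n

lemma isometry_orbitHom : Isometry orbitHom :=
  AddMonoidHomClass.isometry_of_norm orbitHom norm_orbitHom


/-! ### Polynomial phases and binomial coefficients -/

lemma eval_descPochhammer_intCast (n : ℤ) (k : ℕ) :
    (descPochhammer ℝ k).eval (n : ℝ) = k.factorial * (Ring.choose n k : ℤ) := by
  rw [← descPochhammer_eval_cast, Polynomial.eval_eq_smeval,
    Ring.descPochhammer_eq_factorial_smul_choose, nsmul_eq_mul]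
  push_cast
  rfl

lemma exp_eval_eq (p : Polynomial ℝ) (n : ℤ) :
    Complex.exp (2 * Real.pi * Complex.I * ((p.eval (n : ℝ) : ℝ) : ℂ)) =
      (Circle.exp (2 * Real.pi * p.eval (n : ℝ)) : ℂ) := by
  rw [Circle.coe_exp]
  congr 1
  push_cast
  ring

lemma exp_descPochhammer (a : ℝ) (n : ℤ) (k : ℕ) :
    Circle.exp (2 * Real.pi * (Polynomial.C a * descPochhammer ℝ k).eval (n : ℝ)) =
      Circle.exp (2 * Real.pi * a * k.factorial) ^ Ring.choose n k := by
  rw [← Circle.exp_zsmul, Polynomial.eval_mul, Polynomial.eval_C, eval_descPochhammer_intCast,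
    zsmul_eq_mul]
  congr 1
  ring

lemma orbitHom_mem_polyType {χ : C(H, ℂ)} (hχ : χ ∈ charMonoid) : orbitHom χ ∈ polyType := by
  induction hχ using Submonoid.closure_induction with
  | mem χ h =>
    obtain ⟨⟨k, x⟩, rfl⟩ := h
    obtain ⟨θ, rfl⟩ := Circle.exp_surjective x
    -- The denominator `k!` turns the falling factorial into `Ring.choose n k`, and `2π` is the
    -- normalisation of the phase.
    refine ⟨Polynomial.C (θ / (2 * Real.pi * k.factorial)) * descPochhammer ℝ k, fun n => ?_⟩
    rw [exp_eval_eq, exp_descPochhammer, orbitHom_apply]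
    show ((((tau n).1 k).1 (Circle.exp θ) : Circle) : ℂ) = _
    rw [tau_apply]
    congr 4
    have : (k.factorial : ℝ) ≠ 0 := by exact_mod_cast k.factorial_ne_zero
    field_simp
  | one => rw [map_one]; exact polyType_one
  | mul a b _ _ ha hb => rw [map_mul]; exact polyType_mul ha hb

/-- The falling factorial of degree `d` is monic, so subtracting its multiple by the leading
coefficient lowers the degree; the subtracted phase is a single coordinate function. -/
lemma exists_charMonoid_eq_exp (p : Polynomial ℝ) :
    ∃ χ ∈ charMonoid, ∀ n : ℤ,
      χ (tau n) = (Circle.exp (2 * Real.pi * p.eval (n : ℝ)) : ℂ) := by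
  induction hd : p.natDegree using Nat.strong_induction_on generalizing p with
  | _ d ih =>
  have key : ∀ a : ℝ, ∀ k : ℕ, ∀ n : ℤ, evalC k (Circle.exp (2 * Real.pi * a * k.factorial)) (tau n)
      = (Circle.exp (2 * Real.pi * (Polynomial.C a * descPochhammer ℝ k).eval (n : ℝ)) : ℂ) := by
    intro a k n
    rw [exp_descPochhammer, ← tau_apply]
    rfl
  rcases Nat.eq_zero_or_pos d with rfl | hd0
  · rw [Polynomial.eq_C_of_natDegree_eq_zero hd]
    refine ⟨evalC 0 (Circle.exp (2 * Real.pi * p.coeff 0 * (0 : ℕ).factorial)), evalC_mem 0 _,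
      fun n => ?_⟩
    rw [key (p.coeff 0) 0 n]
    simp
  · have hp0 : p ≠ 0 := by
      rintro rfl
      simp at hd
      omega
    set r := Polynomial.C p.leadingCoeff * descPochhammer ℝ d with hr
    have hlt : (p - r).natDegree < d := by
      have hlc : p.leadingCoeff ≠ 0 := Polynomial.leadingCoeff_ne_zero.mpr hp0
      have h1 : r.natDegree = d := by
        rw [hr, Polynomial.natDegree_C_mul hlc, descPochhammer_natDegree]
      have h2 : r.leadingCoeff = p.leadingCoeff := by
        rw [hr, Polynomial.leadingCoeff_mul, Polynomial.leadingCoeff_C,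
          (monic_descPochhammer ℝ d).leadingCoeff, mul_one]
      have hr0 : r ≠ 0 := Polynomial.leadingCoeff_ne_zero.mp (h2 ▸ hlc)
      have hdeg : p.degree = r.degree := by
        rw [Polynomial.degree_eq_natDegree hp0, Polynomial.degree_eq_natDegree hr0, hd, h1]
      have h3 := Polynomial.degree_sub_lt_left hdeg hp0 h2.symm
      rw [Polynomial.degree_eq_natDegree hp0, hd] at h3
      by_cases h0 : p - r = 0
      · rwa [h0, Polynomial.natDegree_zero]
      · exact (Polynomial.natDegree_lt_iff_degree_lt h0).mpr h3
    obtain ⟨χ, hχ, h⟩ := ih _ hlt (p - r) rfl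
    refine ⟨χ * evalC d (Circle.exp (2 * Real.pi * p.leadingCoeff * d.factorial)),
      mul_mem hχ (evalC_mem d _), fun n => ?_⟩
    rw [ContinuousMap.mul_apply, h n, key p.leadingCoeff d n, ← hr, ← Circle.coe_mul,
      ← Circle.exp_add, ← mul_add, Polynomial.eval_sub, sub_add_cancel]

/-- Density of `charAlgebra` gives one inclusion; for the other, the range of an isometry from a
complete space is closed. -/
theorem range_orbitHom : Set.range orbitHom = (weylSubmodule : Set LInfty) := by
  refine Set.Subset.antisymm ?_ ?_
  · rintro _ ⟨f, rfl⟩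
    refine map_mem_closure isometry_orbitHom.continuous (dense_charAlgebra f) fun g hg => ?_
    rw [SetLike.mem_coe, mem_charAlgebra] at hg
    induction hg using Submodule.span_induction with
    | mem χ hχ => exact Submodule.subset_span (orbitHom_mem_polyType hχ)
    | zero => rw [map_zero]; exact Submodule.zero_mem _
    | add f g _ _ hf hg => rw [map_add]; exact Submodule.add_mem _ hf hg
    | smul c g _ hg => rw [map_smul]; exact Submodule.smul_mem _ _ hg
  · have hclosed : IsClosed (Set.range orbitHom) :=
      isometry_orbitHom.isClosedEmbedding.isClosed_range
    have hle : weylSubmodule ≤ LinearMap.range orbitHom.toAlgHom.toLinearMap := by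
      refine Submodule.topologicalClosure_minimal _ (Submodule.span_le.mpr ?_) hclosed
      rintro f ⟨p, hp⟩
      obtain ⟨χ, -, hχ⟩ := exists_charMonoid_eq_exp p
      refine ⟨χ, lp.ext (funext fun n => ?_)⟩
      show χ (tau n) = f n
      rw [hχ, hp, exp_eval_eq]
    exact fun f hf => hle hf

theorem range_pullback_tau :
    Set.range (pullback (X := H) tau) = (weylSubmodule : Set LInfty) := by
  rw [← range_orbitHom]
  refine Set.Subset.antisymm ?_ ?_
  · rintro _ ⟨f, rfl⟩
    exact ⟨f.toContinuousMap, rfl⟩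
  · rintro _ ⟨f, rfl⟩
    exact ⟨_, rfl⟩

/-- The isomorphism of `C(𝓗)` onto the Weyl algebra. -/
def weylEquiv : C(H, ℂ) ≃⋆ₐ[ℂ] weylAlgebra :=
  StarAlgEquiv.ofBijective
    (orbitHom.codRestrict weylAlgebra fun f => range_orbitHom.subset ⟨f, rfl⟩)
    ⟨fun _ _ h => isometry_orbitHom.injective (congrArg Subtype.val h), fun g => by
      obtain ⟨f, hf⟩ := range_orbitHom.superset g.2
      exact ⟨f, Subtype.ext hf⟩⟩

/-- The homeomorphism of character spaces induced by a star isomorphism. -/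
def characterSpaceHomeo {A B : Type*} [NormedCommRing A] [NormedAlgebra ℂ A] [CompleteSpace A]
    [StarRing A] [NormedCommRing B] [NormedAlgebra ℂ B] [CompleteSpace B] [StarRing B]
    (e : A ≃⋆ₐ[ℂ] B) : WeakDual.characterSpace ℂ A ≃ₜ WeakDual.characterSpace ℂ B where
  toFun := WeakDual.CharacterSpace.compContinuousMap (e.symm : B →⋆ₐ[ℂ] A)
  invFun := WeakDual.CharacterSpace.compContinuousMap (e : A →⋆ₐ[ℂ] B)
  left_inv χ := by
    ext a
    exact congrArg χ (e.symm_apply_apply a)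
  right_inv χ := by
    ext b
    exact congrArg χ (e.apply_symm_apply b)
  continuous_toFun := ContinuousMap.continuous _
  continuous_invFun := ContinuousMap.continuous _

instance : CompleteSpace weylAlgebra :=
  (Submodule.isClosed_topologicalClosure (Submodule.span ℂ polyType)).completeSpace_coe

/-! ### The group structure of `𝓗` -/

lemma tau_add (m n : ℤ) : tau (m + n) = tau m * tau n := by
  refine Subtype.ext (funext fun k => Subtype.ext (funext fun x => ?_))
  show _ = (starSeq (tau m).1 (tau n).1 k).1 x
  rw [tau_apply, starSeq_apply, Ring.add_choose_eq k (Commute.all m n), ← prod_zpow_eq]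
  refine Finset.prod_congr rfl fun p _ => ?_
  rw [tau_apply, tau_apply, ← zpow_mul, mul_comm]

lemma mul_apply (φ ψ : H) (k : ℕ) (x : Circle) : ((φ * ψ).1 k).1 x =
    ∏ p ∈ Finset.HasAntidiagonal.antidiagonal k, (φ.1 p.1).1 ((ψ.1 p.2).1 x) :=
  starSeq_apply φ.1 ψ.1 k x

lemma continuous_apply_apply (k : ℕ) (x : Circle) : Continuous fun φ : H => (φ.1 k).1 x :=
  (continuous_eval_HT x).comp ((continuous_apply k).comp continuous_subtype_val)

lemma continuous_to_H {X : Type*} [TopologicalSpace X] {F : X → H}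
    (h : ∀ k x, Continuous fun a => ((F a).1 k).1 x) : Continuous F :=
  continuous_induced_rng.mpr (continuous_pi fun k =>
    continuous_induced_rng.mpr (continuous_pi fun x => h k x))

lemma continuous_mul_right (ψ : H) : Continuous fun φ : H => φ * ψ := by
  refine continuous_to_H fun k x => ?_
  simp only [mul_apply]
  exact continuous_finsetProd _ fun p _ => continuous_apply_apply _ _

/-- In `φ * ψ` the coordinates of `φ` are applied to those of `ψ` and may be discontinuous; those of
`tau n` are power maps. -/
lemma continuous_tau_mul (n : ℤ) : Continuous fun φ : H => tau n * φ := by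
  refine continuous_to_H fun k x => ?_
  simp only [mul_apply, tau_apply]
  exact continuous_finsetProd _ fun p _ => (continuous_apply_apply _ _).zpow _

/-- The right inverse of a sequence for `⋆`, by recursion. -/
def starInv (φ : ℕ → HT) (k : ℕ) : HT :=
  if k = 0 then powHom 1 else (∏ j : Fin k, comp (φ (k - j)) (starInv φ j))⁻¹
termination_by k
decreasing_by exact j.2

lemma starInv_zero (φ : ℕ → HT) : starInv φ 0 = powHom 1 := by
  rw [starInv, if_pos rfl]

lemma starInv_of_pos (φ : ℕ → HT) {k : ℕ} (hk : 0 < k) :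
    starInv φ k = (∏ j ∈ Finset.range k, comp (φ (k - j)) (starInv φ j))⁻¹ := by
  rw [starInv, if_neg hk.ne', Finset.prod_range]

lemma starSeq_starInv {φ : ℕ → HT} (h0 : φ 0 = powHom 1) : starSeq φ (starInv φ) = zeroSeq := by
  have hcomp : ∀ ψ, comp (powHom 1) ψ = ψ := fun ψ =>
    Subtype.ext (funext fun x => zpow_one (ψ.1 x))
  funext k
  rw [starSeq, Finset.prod_range_succ, Nat.sub_self, h0, hcomp]
  rcases Nat.eq_zero_or_pos k with rfl | hk
  · rw [Finset.prod_range_zero, one_mul, starInv_zero]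
    rfl
  · rw [starInv_of_pos φ hk, mul_inv_cancel, zeroSeq, if_neg hk.ne']
    rfl

/-- Where `φ` looks like the integer `n`, its inverse looks like `-n`: Vandermonde's identity for
`-n + n = 0` is the recursion that defines `starInv`. -/
lemma starInv_mem {φ : ℕ → HT} (hφ : φ ∈ setH) : starInv φ ∈ setH := by
  rw [mem_setH_iff] at hφ ⊢
  refine ⟨starInv_zero φ, fun k N hN => ?_⟩
  obtain ⟨n, hn⟩ := hφ.2 k N hN
  refine ⟨-n, fun i => ?_⟩
  induction i using Nat.strong_induction_on with
  | _ i ih =>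
  intro hi x hx
  rcases Nat.eq_zero_or_pos i with rfl | hi0
  · rw [starInv_zero, Ring.choose_zero_right]
    rfl
  · have h := congrArg (fun ψ : HT => ψ.1 x) (congrFun (starSeq_starInv hφ.1) i)
    simp only [starSeq, zeroSeq, if_neg hi0.ne', Finset.prod_range_succ] at h
    rw [coe_mul_apply, coe_prod] at h
    have h1 : ∀ j ∈ Finset.range i, (comp (φ (i - j)) (starInv φ j)).1 x =
        x ^ (Ring.choose n (i - j) * Ring.choose (-n) j) := fun j hj => by
      have hj := Finset.mem_range.mp hj
      show (φ (i - j)).1 ((starInv φ j).1 x) = _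
      rw [ih j hj (by omega) x hx, hn (i - j) (by omega) _ (zpow_torsion hx _), ← zpow_mul,
        mul_comm]
    have h2 : (comp (φ (i - i)) (starInv φ i)).1 x = (starInv φ i).1 x := by
      rw [Nat.sub_self, hφ.1]
      exact zpow_one _
    have h3 : (powHom 0).1 x = 1 := zpow_zero x
    rw [Finset.prod_congr rfl h1, h2, h3, prod_zpow_eq] at h
    have h4 := Ring.add_choose_eq i (Commute.all (-n) n)
    rw [neg_add_cancel, Ring.choose_zero_pos ℤ hi0,
      Finset.Nat.sum_antidiagonal_eq_sum_range_succ_mk, Finset.sum_range_succ, Nat.sub_self,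
      Ring.choose_zero_right, mul_one] at h4
    rw [Finset.sum_congr rfl fun j _ => mul_comm (Ring.choose (-n) j) (Ring.choose n (i - j))] at h4
    rw [eq_neg_of_add_eq_zero_left h4.symm, zpow_neg, inv_mul_eq_one] at h
    exact h.symm

theorem isUnit_H (φ : H) : IsUnit φ := by
  have h : ∀ φ : H, ∃ ψ : H, φ * ψ = 1 := fun φ =>
    ⟨⟨starInv φ.1, starInv_mem φ.2⟩, Subtype.ext (starSeq_starInv φ.2.1)⟩
  obtain ⟨ψ, hψ⟩ := h φ
  obtain ⟨χ, hχ⟩ := h ψ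
  -- In a monoid where every element has a right inverse, right inverses are two-sided.
  have : χ = φ := by
    rw [← one_mul χ, ← hψ, mul_assoc, hχ, mul_one]
  subst this
  exact ⟨⟨χ, ψ, hψ, hχ⟩, rfl⟩

theorem tau_injective : Function.Injective tau := by
  intro m n h
  by_contra hne
  have hd : ((m - n : ℤ) : ℝ) ≠ 0 := by exact_mod_cast sub_ne_zero.mpr hne
  -- In degree one `tau n` is `x ↦ x ^ n`, and this point has `(m - n)`-th power `-1`.
  have h1 := congrArg (fun φ : H => (φ.1 1).1 (Circle.exp (Real.pi / (m - n : ℤ)))) h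
  simp only [tau_apply, Ring.choose_one_right] at h1
  rw [← div_eq_one, div_eq_mul_inv, ← zpow_sub, ← Circle.exp_zsmul, zsmul_eq_mul, mul_div_cancel₀ _ hd] at h1
  have h2 := congrArg (fun z : Circle => (z : ℂ)) h1
  simp only [Circle.coe_exp, Complex.exp_pi_mul_I, Circle.coe_one] at h2
  norm_num at h2

theorem isCompactification_tau :
    IsCompactification (weylSubmodule : Set LInfty) H tau where
  compact := compactSpace_H
  hausdorff := inferInstance
  continuous_mul_right := continuous_mul_right
  map_add := tau_add
  dense := denseRange_tau
  centre := continuous_tau_mul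
  range_pullback := range_pullback_tau

end WeylSystem

end

theorem mainTheorem4 :
    -- `ω_{0̃} C(𝓗)` is the Weyl algebra
    Set.range (WeylSystem.omega WeylSystem.T WeylSystem.zeroH) =
        (WeylSystem.weylSubmodule : Set WeylSystem.LInfty) ∧
    -- `𝓗` is the spectrum of the Weyl algebra, `φ` acting by `ω_{0̃} f ↦ f φ`
    (∃ e : WeylSystem.H ≃ₜ WeakDual.characterSpace ℂ WeylSystem.weylAlgebra,
      ∀ (φ : WeylSystem.H) (g : WeylSystem.weylAlgebra) (f : WeylSystem.H →ᵇ ℂ),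
        WeylSystem.omega WeylSystem.T WeylSystem.zeroH f = (g : WeylSystem.LInfty) →
          e φ g = f φ) ∧
    -- `(τ, 𝓗)`, with the operation `⋆`, is a compactification of `ℤ` for the Weyl algebra
    WeylSystem.IsCompactification (WeylSystem.weylSubmodule : Set WeylSystem.LInfty)
      WeylSystem.H WeylSystem.tau ∧
    -- moreover `𝓗` is a group under `⋆`, and `τ` is injective
    (∀ φ : WeylSystem.H, IsUnit φ) ∧
    Function.Injective WeylSystem.tau := by
  -- `omega T zeroH` unfolds to `pullback tau`. The characters of `C(H, ℂ)` are the point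
  -- evaluations, carried over to the Weyl algebra by `weylEquiv`.
  refine ⟨WeylSystem.range_pullback_tau,
    ⟨(WeakDual.CharacterSpace.homeoEval WeylSystem.H ℂ).trans
      (WeylSystem.characterSpaceHomeo (A := C(WeylSystem.H, ℂ)) (B := WeylSystem.weylAlgebra)
        WeylSystem.weylEquiv), fun φ g f hf => ?_⟩,
    WeylSystem.isCompactification_tau, WeylSystem.isUnit_H, WeylSystem.tau_injective⟩
  have hg : g = WeylSystem.weylEquiv f.toContinuousMap := Subtype.ext hf.symm
  have h1 : WeylSystem.weylEquiv.symm g = f.toContinuousMap := by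
    rw [hg, StarAlgEquiv.symm_apply_apply]
  exact congrArg (fun u : C(WeylSystem.H, ℂ) => u φ) h1
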